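/- All graphs are finite and simple. A *four-graph* is a plane graph (a graph together with an embedding in the plane, equivalently in the sphere) in which every vertex has degree four and every face, including the outer face, has size $3$ or $4$. A *distance-two five-coloring* of a graph $G$ is a map $c:V(G)\to\{1,\dots,5\}$ such that for every vertex $v$ the colors of $v$ and of all its neighbors are pairwise distinct. Let $G_0$ be the graph with $10$ vertices obtained from the cube by inserting a new vertex in each of two opposite square faces and joining it to the four vertices of that face. Let $G_1$ be the graph with $30$ vertices obtained from the cube as follows. Replace each vertex $v$ of the cube by a triangle with corners $(v,e)$, one for each cube edge $e$ at $v$; each cube edge $e=vw$ now joins $(v,e)$ and $(w,e)$, and each face of the cube becomes an octagon. Insert a new vertex in each of the six octagons and join it to every other vertex of the octagon, namely, traversing each octagon in the counterclockwise direction as seen from outside the cube, to the four vertices at which the traversal enters the cube edges of that octagon. (Thus each corner $(v,e)$ is joined to exactly one inserted vertex.) **Theorem.** $G_0$ and $G_1$ have plane embeddings that are four-graphs, and a four-graph $G$ admits a distance-two five-coloring if and only if it is isomorphic, as a plane graph (up to homeomorphisms of the sphere, possibly orientation-reversing), to one of these two embedded graphs. Moreover, each of $G_0$ and $G_1$ has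 a distance-two five-coloring, and it is unique up to permutation of the colors. -/

import Mathlib

/-- A distance-two `r`-coloring of `G`: at every vertex `v`, the colors of `v` and of all the
neighbors of `v` are pairwise distinct. -/
def IsDistanceTwoColoring {V : Type*} (G : SimpleGraph V) {r : ℕ} (c : V → Fin r) : Prop :=
  ∀ v : V, Set.InjOn c (insert v (G.neighborSet v))

/-- A combinatorial embedding in the sphere of a finite simple graph without isolated vertices
(connected or not).

* `rot` is the rotation system: `rot d` is the dart that follows `d` in the cyclic order of the
  darts leaving the vertex `d.fst`.
* The facial walks are the orbits of `d ↦ rot d.symm`. `face d e` says that `d` and `e` border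
  the same face (on a fixed side). A facial walk lies in one face, but one face may be bordered by
  several facial walks, as happens when the graph is not connected.
* `sphere_connected`: the surface obtained from the faces and the graph is connected.
* `euler`: Euler's formula `|V| - |E| + |F| = 1 + (number of connected components)`. For a
  connected surface it says that every component of `G` is embedded with genus zero and that the
  faces, each with its boundary walks, glue the components together in a tree-like way, that is,
  that the surface is the sphere. If `G` is connected, each facial walk is a face, and this is
  the usual formula `|V| - |E| + |F| = 2`. -/
structure PlaneEmbedding {V : Type*} [Finite V] (G : SimpleGraph V) where
  rot : Equiv.Perm G.Dart
  rot_fst : ∀ d : G.Dart, (rot d).fst = d.fst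
  rot_cyclic : ∀ d e : G.Dart, d.fst = e.fst → rot.SameCycle d e
  face : Setoid G.Dart
  face_next : ∀ d : G.Dart, face d (rot d.symm)
  sphere_connected : ∀ u v : V, Relation.EqvGen
    (fun x y => G.Adj x y ∨ ∃ d e : G.Dart, d.fst = x ∧ e.fst = y ∧ face d e) u v
  euler : Nat.card V + Nat.card (Quotient face) =
    1 + Nat.card G.ConnectedComponent + Nat.card G.edgeSet

namespace PlaneEmbedding

variable {V W : Type*} [Finite V] [Finite W] {G : SimpleGraph V} {H : SimpleGraph W}

/-- The size of the face bordered by the dart `d`: the number of its edges, where an edge with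
the face on both sides counts twice. -/
noncomputable def faceSize (P : PlaneEmbedding G) (d : G.Dart) : ℕ :=
  Nat.card {e : G.Dart // P.face d e}

/-- A four-graph: a plane graph with all degrees four, all of whose faces have size 3 or 4. -/
def IsFourGraph (P : PlaneEmbedding G) : Prop :=
  (∀ v : V, (G.neighborSet v).ncard = 4) ∧ ∀ d : G.Dart, P.faceSize d = 3 ∨ P.faceSize d = 4

/-- Isomorphism of plane graphs: a graph isomorphism that carries rotations to rotations and
faces to faces, either preserving or reversing the orientation of the sphere. In the
second case the rotations are inverted and the two sides of each dart are exchanged. -/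
def IsIsomorphic (P : PlaneEmbedding G) (Q : PlaneEmbedding H) : Prop :=
  ∃ φ : G ≃g H,
    ((∀ d : G.Dart, φ.toHom.mapDart (P.rot d) = Q.rot (φ.toHom.mapDart d)) ∧
      ∀ d e : G.Dart, P.face d e ↔ Q.face (φ.toHom.mapDart d) (φ.toHom.mapDart e)) ∨
    ((∀ d : G.Dart, Q.rot (φ.toHom.mapDart (P.rot d)) = φ.toHom.mapDart d) ∧
      ∀ d e : G.Dart, P.face d.symm e.symm ↔ Q.face (φ.toHom.mapDart d) (φ.toHom.mapDart e))

end PlaneEmbedding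

/-- The vertices of the cube. -/
abbrev CubeVertex : Type := Fin 3 → Bool

/-- The other end of the cube edge in direction `i` at the vertex `v`. -/
def CubeVertex.flip (v : CubeVertex) (i : Fin 3) : CubeVertex := Function.update v i (!v i)

/-- The vertices of the cube with an even number of coordinates equal to `true`. -/
def CubeVertex.IsEven (v : CubeVertex) : Prop := xor (xor (v 0) (v 1)) (v 2) = false

instance (v : CubeVertex) : Decidable v.IsEven :=
  inferInstanceAs (Decidable (xor (xor (v 0) (v 1)) (v 2) = false))

/-- `inl v` is a vertex of the cube, and `inr b` is the vertex inserted in the face `v 0 = b`. -/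
abbrev G0Vertex : Type := CubeVertex ⊕ Bool

/-- The edges of `G0`, each listed in at least one direction. -/
def G0Rel : G0Vertex → G0Vertex → Prop
  | .inl v, .inl w => ∃ i : Fin 3, w = v.flip i
  | .inr b, .inl v => v 0 = b
  | _, _ => False

/-- The graph `G0`: the cube, with a new vertex inserted in each of two opposite faces and joined
to the four vertices of that face. -/
def G0 : SimpleGraph G0Vertex := SimpleGraph.fromRel G0Rel

/-- `inl (v, i)` is the corner, on the cube edge in direction `i` at `v`, of the triangle that
replaces the vertex `v` of the cube; `inr (k, b)` is the vertex inserted in the cube face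
`v k = b`. -/
abbrev G1Vertex : Type := (CubeVertex × Fin 3) ⊕ (Fin 3 × Bool)

/-- The edges of `G1`, each listed in at least one direction: the edges of the triangles, the
edges of the cube, and the edges at the inserted vertices. The addition is modulo 3. The edge of
the cube that contains the corner `(v, i)` lies in the two faces of directions `i + 1` and
`i + 2` at `v`; the corner is joined to the vertex inserted in exactly one of them, depending
on the parity of `v`. Hence an inserted vertex is joined to every other vertex of the octagon
that replaces its face. -/
def G1Rel : G1Vertex → G1Vertex → Prop
  | .inl (v, i), .inl (w, j) => (v = w ∧ i ≠ j) ∨ (i = j ∧ w = v.flip i)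
  | .inr (k, b), .inl (v, i) => v k = b ∧ k = if v.IsEven then i + 1 else i + 2
  | _, _ => False

/-- The graph `G1`: the cube with each vertex replaced by a triangle, and with a new vertex
inserted in each of its six faces and joined to alternate vertices of the surrounding octagon. -/
def G1 : SimpleGraph G1Vertex := SimpleGraph.fromRel G1Rel

/-- `G` has a distance-two five-coloring, and any two of them differ by a permutation of the
five colors. -/
def HasUniqueDistanceTwoFiveColoring {V : Type*} (G : SimpleGraph V) : Prop :=
  ∃ c : V → Fin 5, IsDistanceTwoColoring G c ∧
    ∀ c' : V → Fin 5, IsDistanceTwoColoring G c' → ∃ π : Equiv.Perm (Fin 5), c' = π ∘ c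

/-! At every vertex of degree four, the vertex and its neighbors use all five colors. In a square
face the vertex opposite to a corner differs in color from the rest of the face, so it repeats the
color of one of the two neighbors of the corner off the face. That choice is the label `one` or
`two` of the corner; corners of triangles get `tri`. The two ends of an edge see the same three
remaining colors in one of six relative orders, and each order amounts to one pattern of the four
labels beside the edge (`ColoredMap.edge_labels`). Following the colors once around a triangle gives
`parity`.

These rules on labels are rigid. On a connected map with a triangle (`isWorld_trichotomy`), either
two triangles share an edge and every vertex looks as in `G0`, or no two do and every vertex looks
as in `G1` or in its mirror image. In each case the labels around a dart determine those around its
reversal (`SameKinds`), so labels and colors continue uniquely from one dart to the whole map. This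
already gives uniqueness of the coloring.

For the classification, continue from one dart of the given four-graph and one of `G0` or `G1`. In
the model, different darts see the colors in different orders, so each dart of the four-graph
corresponds to exactly one dart of the model (`exists_hom`), which is a covering. By Euler's formula
every four-graph has exactly eight triangles, hence 24 corners in triangles, so the covering has one
sheet (`bijective_of_card`). A bijection of darts that respects rotation and reversal is an
isomorphism of plane graphs. -/

/-! ### Corner labels and their local rules. -/

/-- The label of a corner of a five-colored four-graph: whether the face at the corner is a triangle
and, if it is a square, whether the color of the opposite vertex is the next one after the
corner or the second next in the rotation. -/
inductive CornerLabel
  | one | two | tri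
  deriving DecidableEq

open CornerLabel

/-- Darts with a rotation `r` and an edge reversal `s` and labels at the corners, subject to the
local rules that hold for five-colored four-graphs. The corner of `d` precedes `d` in the rotation,
and the faces are the orbits of `d ↦ r (s d)`. -/
structure LabelledMap (D : Type*) where
  r : D → D
  s : D → D
  k : D → CornerLabel
  r4 : ∀ d, r (r (r (r d))) = d
  s2 : ∀ d, s (s d) = d
  tri_face : ∀ d, k d = tri → r (s (r (s (r (s d))))) = d
  sq_face : ∀ d, k d ≠ tri → r (s (r (s (r (s (r (s d))))))) = d
  edge : ∀ d,
    (k d = one ∧ k (r d) = one ∧ k (s d) = one ∧ k (r (s d)) = one) ∨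
    (k d = two ∧ k (r d) = two ∧ k (s d) = two ∧ k (r (s d)) = two) ∨
    (k d = one ∧ k (r d) = two ∧ k (s d) = one ∧ k (r (s d)) = two) ∨
    (k d = tri ∧ k (r d) = one ∧ k (s d) = two ∧ k (r (s d)) = tri) ∨
    (k d = two ∧ k (r d) = tri ∧ k (s d) = tri ∧ k (r (s d)) = one) ∨
    (k d = tri ∧ k (r d) = tri ∧ k (s d) = tri ∧ k (r (s d)) = tri)
  parity : ∀ d, k d = tri → k (r d) = tri → (k (r (r (r d))) = tri ↔ k (r (r (s d))) ≠ tri)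

namespace LabelledMap

variable {D : Type*} (M : LabelledMap D)

/-- The labels around the vertex of `d`, starting at `d`. -/
def kind (d : D) : CornerLabel × CornerLabel × CornerLabel × CornerLabel :=
  (M.k d, M.k (M.r d), M.k (M.r (M.r d)), M.k (M.r (M.r (M.r d))))

/-- Every dart can be reached from every other one. -/
def Transitive : Prop :=
  ∀ (p : D → Prop) (d₀ : D), p d₀ → (∀ d, p d → p (M.r d)) → (∀ d, p d → p (M.s d)) → ∀ d, p d

/-- The label of a corner in the mirror image. -/
def swapLabel : CornerLabel → CornerLabel
  | one => two
  | two => one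
  | tri => tri

theorem swapLabel_eq_tri {a : CornerLabel} : swapLabel a = tri ↔ a = tri := by
  cases a <;> simp [swapLabel]

/-- The mirror image. -/
def mirror : LabelledMap D where
  r d := M.r (M.r (M.r d))
  s := M.s
  k d := swapLabel (M.k (M.r d))
  r4 d := by simp [M.r4]
  s2 := M.s2
  tri_face d h := by
    -- The mirrored facial walk runs backwards around the face of `r d`; its steps are undone one at
    -- a time by `s ∘ r³`, the inverse of `r ∘ s`.
    have h1 := M.tri_face (M.r d) (swapLabel_eq_tri.1 h)
    have a1 := congrArg (fun x => M.s (M.r (M.r (M.r x)))) h1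
    simp only [M.r4, M.s2] at a1
    have a2 := congrArg (fun x => M.s (M.r (M.r (M.r x)))) a1
    simp only [M.r4, M.s2] at a2
    have a3 := congrArg (fun x => M.r (M.r (M.r x))) a2
    simp only [M.r4] at a3
    rw [← a3, M.s2, M.r4]
  sq_face d h := by
    have h1 := M.sq_face (M.r d) (fun h' => h (swapLabel_eq_tri.2 h'))
    have a1 := congrArg (fun x => M.s (M.r (M.r (M.r x)))) h1
    simp only [M.r4, M.s2] at a1
    have a2 := congrArg (fun x => M.s (M.r (M.r (M.r x)))) a1
    simp only [M.r4, M.s2] at a2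
    have a3 := congrArg (fun x => M.s (M.r (M.r (M.r x)))) a2
    simp only [M.r4, M.s2] at a3
    have a4 := congrArg (fun x => M.r (M.r (M.r x))) a3
    simp only [M.r4] at a4
    rw [← a4, M.s2, M.r4]
  edge d := by
    have h := M.edge d
    rcases h with h | h | h | h | h | h <;> simp [M.r4, h, swapLabel]
  parity d := by
    -- The mirror image exchanges the two triangles at the edge, and so does reversing the dart.
    have h := M.parity (M.s d)
    have h' := M.edge d
    simp only [M.r4, M.s2, swapLabel_eq_tri, ne_eq] at h ⊢
    grind

/-- A labelled map in which a triangle has a common edge with another one has the labels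
of `G0`. -/
def IsWorld0 : Prop := ∀ d,
  (M.kind d = (tri, tri, tri, tri) ∧ M.kind (M.s d) = (tri, tri, one, two)) ∨
  (M.kind d = (tri, tri, one, two) ∧ M.kind (M.s d) = (tri, tri, tri, tri)) ∨
  (M.kind d = (tri, one, two, tri) ∧ M.kind (M.s d) = (two, tri, tri, one)) ∨
  (M.kind d = (two, tri, tri, one) ∧ M.kind (M.s d) = (tri, one, two, tri)) ∨
  (M.kind d = (one, two, tri, tri) ∧ M.kind (M.s d) = (one, two, tri, tri))

/-- The labels of `G1`, with one of the two orientations. -/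
def IsWorld1 : Prop := ∀ d,
  (M.kind d = (tri, one, two, two) ∧ M.kind (M.s d) = (two, tri, one, two)) ∨
  (M.kind d = (two, tri, one, two) ∧ M.kind (M.s d) = (tri, one, two, two)) ∨
  (M.kind d = (one, two, two, tri) ∧ M.kind (M.s d) = (one, two, two, tri)) ∨
  (M.kind d = (two, two, tri, one) ∧ M.kind (M.s d) = (two, two, two, two)) ∨
  (M.kind d = (two, two, two, two) ∧ M.kind (M.s d) = (two, two, tri, one))

/-- By `edge`, each step around a vertex either repeats the label or advances in the cycle `one`,
`two`, `tri`, `one`. Four steps that close up contain zero advances (a constant kind) or three (one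
full turn with one label repeated). -/
theorem kind_cases (d : D) :
    M.kind d ∈ [(one, one, one, one), (two, two, two, two), (tri, tri, tri, tri),
      (tri, one, one, two), (one, one, two, tri), (one, two, tri, one), (two, tri, one, one),
      (tri, one, two, two), (one, two, two, tri), (two, two, tri, one), (two, tri, one, two),
      (tri, tri, one, two), (tri, one, two, tri), (one, two, tri, tri), (two, tri, tri, one)] := by
  have h0 := M.edge d
  have h1 := M.edge (M.r d)
  have h2 := M.edge (M.r (M.r d))
  have h3 := M.edge (M.r (M.r (M.r d)))
  simp only [M.r4] at h3
  simp only [kind]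
  generalize M.k d = a at *
  generalize M.k (M.r d) = b at *
  generalize M.k (M.r (M.r d)) = c at *
  generalize M.k (M.r (M.r (M.r d))) = e at *
  revert h0 h1 h2 h3
  cases a <;> cases b <;> cases c <;> cases e <;> simp

end LabelledMap

/-! ### Maps in which two triangles share an edge. -/

namespace LabelledMap

variable {D : Type*} (M : LabelledMap D)

/-- Since `s ∘ r³` steps back along a face, the last dart of a face can be reached from `d` in
either direction. This and `sq_back` identify darts met on both ways around. -/
theorem tri_back (d : D) (h : M.k d = tri) :
    M.r (M.s (M.r (M.s d))) = M.s (M.r (M.r (M.r d))) := by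
  have := congrArg (fun x => M.s (M.r (M.r (M.r x)))) (M.tri_face d h)
  simpa only [M.r4, M.s2] using this

theorem sq_back (d : D) (h : M.k d ≠ tri) :
    M.r (M.s (M.r (M.s (M.r (M.s d))))) = M.s (M.r (M.r (M.r d))) := by
  have := congrArg (fun x => M.s (M.r (M.r (M.r x)))) (M.sq_face d h)
  simpa only [M.r4, M.s2] using this

theorem kind_r {d : D} {a b c e : CornerLabel} (h : M.kind d = (a, b, c, e)) :
    M.kind (M.r d) = (b, c, e, a) := by
  simp only [kind, Prod.mk.injEq, M.r4] at h ⊢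
  tauto

theorem kind_of_r {d : D} {a b c e : CornerLabel} (h : M.kind (M.r d) = (b, c, e, a)) :
    M.kind d = (a, b, c, e) := by
  simp only [kind, Prod.mk.injEq, M.r4] at h ⊢
  tauto

theorem kind_r3 {d : D} {a b c e : CornerLabel} (h : M.kind d = (a, b, c, e)) :
    M.kind (M.r (M.r (M.r d))) = (e, a, b, c) :=
  M.kind_r (M.kind_r (M.kind_r h))

theorem kind_of_r3 {d : D} {a b c e : CornerLabel}
    (h : M.kind (M.r (M.r (M.r d))) = (e, a, b, c)) : M.kind d = (a, b, c, e) :=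
  M.kind_of_r (M.kind_of_r (M.kind_of_r h))

/-- By `parity`, a triangle that shares one edge with a triangle shares exactly one of its other two
edges. Here the shared one starts at the vertex of `d`, so the third edge borders a square. -/
theorem kind_s_of_tri_tri_tri {d : D} (h : M.kind d = (tri, tri, tri, tri)) :
    M.kind (M.s d) = (tri, tri, one, two) := by
  have h1 := M.edge d
  have h2 := M.parity d
  have h3 := M.kind_cases (M.s d)
  simp only [kind, Prod.mk.injEq, List.mem_cons, List.not_mem_nil] at *
  grind

theorem kind_s_of_tri_tri_one {d : D} (h : M.kind d = (tri, tri, one, two)) :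
    M.kind (M.s d) = (tri, tri, tri, tri) := by
  have h1 := M.edge d
  have h2 := M.parity d
  have h3 := M.kind_cases (M.s d)
  simp only [kind, Prod.mk.injEq, List.mem_cons, List.not_mem_nil] at *
  grind

theorem k_eq {d : D} {a b c e : CornerLabel} (h : M.kind d = (a, b, c, e)) : M.k d = a := by
  simp only [kind, Prod.mk.injEq] at h; exact h.1

/-- The dart `d` is a rim edge of a wheel of four triangles; its far end is reached by going through
the hub. -/
theorem kind_s_of_tri_one_two_tri {d : D} (h : M.kind d = (tri, one, two, tri)) :
    M.kind (M.s d) = (two, tri, tri, one) := by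
  have h1 := M.kind_s_of_tri_tri_one (M.kind_r3 h)
  rw [← M.tri_back d (M.k_eq h)] at h1
  have h2 := M.kind_s_of_tri_tri_tri (M.kind_of_r h1)
  rw [M.s2] at h2
  exact M.kind_of_r h2

theorem kind_s_of_two_tri_tri_one {d : D} (h : M.kind d = (two, tri, tri, one)) :
    M.kind (M.s d) = (tri, one, two, tri) := by
  have h0 : M.k (M.s d) = tri := by
    have := M.edge d
    simp only [kind, Prod.mk.injEq] at h
    grind
  have h1 := M.kind_s_of_tri_tri_one (M.kind_r h)
  have h2 := M.tri_back _ h0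
  rw [M.s2] at h2
  have h3 := M.kind_r h1
  rw [h2] at h3
  have h4 := M.kind_s_of_tri_tri_tri h3
  rw [M.s2] at h4
  exact M.kind_of_r3 h4

/-- Both faces at `d` are squares, and in each of them the side next to `d` is a rim edge whose far
end is already known. Hence the side opposite to `d` is again labelled `one`, `two`, and the
remaining side can only lie on a triangle at the far end of `d`. -/
theorem kind_s_of_one_two_tri_tri {d : D} (h : M.kind d = (one, two, tri, tri)) :
    M.kind (M.s d) = (one, two, tri, tri) := by
  have e0 := M.edge d
  have left := M.sq_back d (by simp [M.k_eq h])
  have l3 := M.kind_s_of_tri_one_two_tri (M.kind_r3 h)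
  have l2 := M.kind_r3 l3
  rw [← left] at l2 l3
  rw [M.r4] at l2
  have right := M.sq_back (M.s d) (by simp only [kind, Prod.mk.injEq] at h; grind)
  have r1 := M.kind_r (M.kind_s_of_two_tri_tri_one (M.kind_r h))
  rw [M.s2] at right
  have e1 := M.edge (M.r (M.s d))
  have e2 := M.edge (M.s (M.r (M.s (M.r (M.s d)))))
  have e3 := M.edge (M.r (M.s (M.r d)))
  have e4 := M.edge (M.r (M.r (M.r (M.s d))))
  have c := M.kind_cases (M.s d)
  have r4 := M.r4 (M.s d)
  simp only [M.s2] at e2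
  simp only [kind, Prod.mk.injEq, List.mem_cons, List.not_mem_nil] at *
  grind

theorem kind_eq_of_tri_tri {d : D} (h : M.k d = tri) (h' : M.k (M.r d) = tri) :
    M.kind d = (tri, tri, tri, tri) ∨ M.kind d = (tri, tri, one, two) := by
  have c := M.kind_cases d
  simp only [kind, Prod.mk.injEq, List.mem_cons, List.not_mem_nil] at *
  grind

theorem isWorld0_of_tri_tri (hM : M.Transitive) {d : D} (h : M.k d = tri)
    (h' : M.k (M.r d) = tri) : M.IsWorld0 := by
  have key : ∀ d, M.kind d = (tri, tri, tri, tri) ∨ M.kind d = (tri, tri, one, two) ∨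
      M.kind d = (tri, one, two, tri) ∨ M.kind d = (two, tri, tri, one) ∨
      M.kind d = (one, two, tri, tri) := by
    refine hM _ d ?_ ?_ ?_
    · have := M.kind_eq_of_tri_tri h h'
      tauto
    · rintro d (h | h | h | h | h) <;> simp [M.kind_r h]
    · rintro d (h | h | h | h | h)
      · simp [M.kind_s_of_tri_tri_tri h]
      · simp [M.kind_s_of_tri_tri_one h]
      · simp [M.kind_s_of_tri_one_two_tri h]
      · simp [M.kind_s_of_two_tri_tri_one h]
      · simp [M.kind_s_of_one_two_tri_tri h]
  intro d
  rcases key d with h | h | h | h | h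
  · simp [h, M.kind_s_of_tri_tri_tri h]
  · simp [h, M.kind_s_of_tri_tri_one h]
  · simp [h, M.kind_s_of_tri_one_two_tri h]
  · simp [h, M.kind_s_of_two_tri_tri_one h]
  · simp [h, M.kind_s_of_one_two_tri_tri h]

end LabelledMap

/-! ### Maps in which no two triangles share an edge. -/

namespace LabelledMap

variable {D : Type*} (M : LabelledMap D)

/-- No two triangles have a common edge. -/
def TrianglesApart : Prop := ∀ d, M.k d = tri → M.k (M.r d) ≠ tri

variable {M}

theorem Transitive.mirror (hM : M.Transitive) : M.mirror.Transitive := by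
  intro p d₀ h₀ hr hs
  refine hM p d₀ h₀ (fun d hd => ?_) hs
  have := hr _ (hr _ (hr _ hd))
  simpa only [LabelledMap.mirror, M.r4] using this

theorem TrianglesApart.mirror (h : M.TrianglesApart) : M.mirror.TrianglesApart := by
  intro d h1 h2
  simp only [LabelledMap.mirror, swapLabel_eq_tri, M.r4] at h1 h2
  exact h d h2 h1

theorem TrianglesApart.kind_cases (h : M.TrianglesApart) (d : D) :
    M.kind d ∈ [(one, one, one, one), (two, two, two, two),
      (tri, one, one, two), (one, one, two, tri), (one, two, tri, one), (two, tri, one, one),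
      (tri, one, two, two), (one, two, two, tri), (two, two, tri, one), (two, tri, one, two)] := by
  have h0 := M.kind_cases d
  have h1 := h d
  have h2 := h (M.r d)
  have h3 := h (M.r (M.r d))
  have h4 := h (M.r (M.r (M.r d)))
  rw [M.r4] at h4
  simp only [kind, Prod.mk.injEq, List.mem_cons, List.not_mem_nil] at *
  rcases h0 with h0 | h0 | h0 | h0 | h0 | h0 | h0 | h0 | h0 | h0 | h0 | h0 | h0 | h0 | h0 | h0 <;>
    simp_all

theorem kind_mirror {d : D} {a b c e : CornerLabel} :
    M.mirror.kind d = (swapLabel a, swapLabel b, swapLabel c, swapLabel e) ↔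
      M.kind d = (b, a, e, c) := by
  have inj : ∀ a b : CornerLabel, swapLabel a = swapLabel b ↔ a = b := by
    intro a b; cases a <;> cases b <;> simp [swapLabel]
  simp only [kind, Prod.mk.injEq, mirror, M.r4, inj]
  tauto

/-- In a square with four labels `one`, `edge` gives three consecutive labels `one` at each vertex,
which force the fourth. Then the squares across its edges are of the same sort, and by connectedness
no triangle is left. -/
theorem face_not_one (hM : M.Transitive) (hA : M.TrianglesApart) (hT : ∃ d, M.k d = tri) (d : D)
    (h0 : M.k d = one) (h1 : M.k (M.r (M.s d)) = one) (h2 : M.k (M.r (M.s (M.r (M.s d)))) = one)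
    (h3 : M.k (M.s (M.r (M.r (M.r d)))) = one) : False := by
  let p : D → Prop := fun d => M.k d = one ∧ M.k (M.r (M.s d)) = one ∧
    M.k (M.r (M.s (M.r (M.s d)))) = one ∧ M.k (M.s (M.r (M.r (M.r d)))) = one
  have hkind : ∀ d, p d → M.kind d = (one, one, one, one) := by
    rintro d ⟨h0, h1, h2, h3⟩
    have e0 := M.edge d
    have e3 := M.edge (M.r (M.r (M.r d)))
    rw [M.r4] at e3
    have c := hA.kind_cases d
    simp only [kind, Prod.mk.injEq, List.mem_cons, List.not_mem_nil] at *
    grind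
  have hphi : ∀ d, p d → p (M.r (M.s d)) := by
    rintro d ⟨h0, h1, h2, h3⟩
    have := M.sq_back d (by simp [h0])
    refine ⟨h1, h2, by rw [this]; exact h3, ?_⟩
    rw [M.r4, M.s2]; exact h0
  have hs : ∀ d, p d → p (M.s d) := by
    intro d hd
    have k0 := hkind _ hd
    have k1 := hkind _ (hphi d hd)
    have e0 := M.edge d
    have e1 := M.edge (M.r d)
    have e3 := M.edge (M.r (M.r (M.r (M.s d))))
    have r4 := M.r4 (M.s d)
    simp only [p, M.s2]
    simp only [kind, Prod.mk.injEq] at *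
    grind
  have hall := hM p d ⟨h0, h1, h2, h3⟩ (fun d hd => by simpa only [M.s2] using hphi _ (hs _ hd)) hs
  obtain ⟨t, ht⟩ := hT
  have := (hall t).1
  rw [ht] at this
  cases this

theorem face_not_two (hM : M.Transitive) (hA : M.TrianglesApart) (hT : ∃ d, M.k d = tri) (d : D)
    (h0 : M.k d = two) (h1 : M.k (M.r (M.s d)) = two) (h2 : M.k (M.r (M.s (M.r (M.s d)))) = two)
    (h3 : M.k (M.s (M.r (M.r (M.r d)))) = two) : False := by
  have hT' : ∃ d, M.mirror.k d = tri := by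
    obtain ⟨t, ht⟩ := hT
    exact ⟨M.r (M.r (M.r t)), by simp only [mirror, M.r4, ht, swapLabel]⟩
  refine face_not_one hM.mirror hA.mirror hT' (M.s d) ?_ ?_ ?_ ?_
  · simp only [mirror, h1, swapLabel]
  · simp only [mirror, M.s2, M.r4, h0, swapLabel]
  · simp only [mirror, M.s2, M.r4, h3, swapLabel]
  · simp only [mirror, M.r4, h2, swapLabel]

/-- Two adjacent vertices with all labels `two` would lie on a square with four labels `two`. -/
theorem kind_s_of_two_two_two (hM : M.Transitive) (hA : M.TrianglesApart)
    (hT : ∃ d, M.k d = tri) {d : D} (h : M.kind d = (two, two, two, two)) :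
    M.kind (M.s d) = (two, two, tri, one) := by
  have hf := face_not_two hM hA hT d
  have c := hA.kind_cases (M.s d)
  have e0 := M.edge d
  have e1 := M.edge (M.r (M.s d))
  have e3 := M.edge (M.r (M.r (M.r d)))
  rw [M.r4] at e3
  simp only [kind, Prod.mk.injEq, List.mem_cons, List.not_mem_nil] at *
  grind

end LabelledMap

namespace LabelledMap

variable {D : Type*} {M : LabelledMap D}

/-- Around the edge `d` between two vertices of triangles whose labels contain `one, one`. -/
theorem TrianglesApart.kinds_near_one_one (hA : M.TrianglesApart) {d : D}
    (h : M.kind d = (one, one, two, tri)) (hs : M.kind (M.s d) = (one, one, two, tri)) :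
    M.kind (M.s (M.r (M.r (M.r d)))) = (two, tri, one, two) ∧
    M.kind (M.s (M.r (M.s d))) = (one, two, two, tri) ∧
    M.kind (M.s (M.r (M.r (M.r (M.s (M.r (M.r (M.r d)))))))) = (two, two, tri, one) := by
  have back := M.sq_back d (by simp [M.k_eq h])
  have e1 := M.edge (M.r (M.s d))
  have e2 := M.edge (M.r (M.s (M.r (M.s d))))
  have e3 := M.edge (M.r (M.r (M.r d)))
  have c2 := hA.kind_cases (M.r (M.s (M.r (M.s d))))
  have c3 := hA.kind_cases (M.s (M.r (M.r (M.r d))))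
  have f := congrArg (fun x => M.r (M.r (M.r x))) back
  simp only [M.r4] at f e3
  rw [← f, M.s2]
  rw [back] at e2
  rw [f] at e2
  have r4 := M.r4 (M.s (M.r (M.s d)))
  simp only [kind, Prod.mk.injEq, List.mem_cons, List.not_mem_nil] at *
  grind

/-- The labels around the square of `d` are `two`, `two`, `one`, `one`. So the edge opposite to `d`
is labelled `one`, `one` at both ends, which leaves a single kind. -/
theorem TrianglesApart.kind_near_two_two (hA : M.TrianglesApart) {d : D}
    (h : M.kind d = (two, two, tri, one)) (hs : M.kind (M.s d) = (two, two, tri, one)) :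
    M.kind (M.s (M.r (M.r (M.r d)))) = (one, two, tri, one) := by
  have back := M.sq_back d (by simp [M.k_eq h])
  have e1 := M.edge (M.r (M.s d))
  have e2 := M.edge (M.r (M.s (M.r (M.s d))))
  have e3 := M.edge (M.r (M.r (M.r d)))
  have c3 := hA.kind_cases (M.s (M.r (M.r (M.r d))))
  have f := congrArg (fun x => M.r (M.r (M.r x))) back
  simp only [M.r4] at f e3
  rw [back] at e2
  rw [f] at e2
  simp only [kind, Prod.mk.injEq, List.mem_cons, List.not_mem_nil] at *
  grind

/-- The hypotheses fix the kinds at the other vertices of the two squares at `d`. The triangle at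
the start of `d` has a third vertex, the end of `r (r d)`, with two possible kinds, and each of them
contradicts the rules on a square across a side of this triangle. -/
theorem TrianglesApart.not_one_one (hA : M.TrianglesApart) {d : D}
    (h : M.kind d = (one, one, two, tri)) (hs : M.kind (M.s d) = (one, one, two, tri)) :
    False := by
  obtain ⟨a1, -, a3⟩ := hA.kinds_near_one_one h hs
  have b2 := (hA.kinds_near_one_one hs (by rwa [M.s2])).2.1
  rw [M.s2] at b2
  have c1 := hA.kind_near_two_two (M.kind_r3 a1) a3
  simp only [M.r4] at c1
  set x := M.r (M.r (M.r d)) with hx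
  have kx := M.kind_r3 h
  rw [← hx] at kx
  have tb := M.tri_back x (M.k_eq kx)
  have ey := M.edge (M.r (M.r d))
  have cy := hA.kind_cases (M.s (M.r (M.r d)))
  have hy : M.kind (M.s (M.r (M.r d))) = (tri, one, one, two) ∨
      M.kind (M.s (M.r (M.r d))) = (tri, one, two, two) := by
    simp only [kind, Prod.mk.injEq, List.mem_cons, List.not_mem_nil] at *
    grind
  rcases hy with hy | hy
  -- The square across the side `r (r d)`; it also contains the edge `r d`, whose end is known from
  -- `b2`.
  · have back := M.sq_back (M.r (M.r d)) (by
      simp only [kind, Prod.mk.injEq] at h; simp [h])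
    simp only [M.r4] at back
    have f := congrArg (fun x => M.r (M.r (M.r x))) back
    simp only [M.r4] at f
    have k1 := M.kind_r hy
    have e1 := M.edge (M.r (M.s (M.r (M.r d))))
    have e2 := M.edge (M.r (M.s (M.r (M.s (M.r (M.r d))))))
    have k3 := M.kind_r3 b2
    rw [back, f] at e2
    simp only [kind, Prod.mk.injEq] at *
    grind
  · have k0 := M.kind_r3 hy
    rw [hx] at tb
    simp only [M.r4] at tb
    rw [← tb, M.r4, ← hx] at k0
    -- The square across the side opposite to the start of `d`; `c1` gives the kind at its next
    -- vertex.
    have back := M.sq_back (M.s (M.r (M.s x))) (by simp [M.k_eq k0])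
    rw [M.s2] at back
    have k2 := M.kind_r c1
    have e2 := M.edge (M.r (M.s (M.r (M.r (M.s x)))))
    have e3 := M.edge (M.r (M.r (M.r (M.s (M.r (M.s x))))))
    rw [back] at e2
    rw [M.r4] at e3
    simp only [kind, Prod.mk.injEq] at *
    grind

theorem TrianglesApart.not_two_two (hA : M.TrianglesApart) {d : D}
    (h : M.kind d = (two, two, tri, one)) (hs : M.kind (M.s d) = (two, two, tri, one)) :
    False := by
  refine hA.mirror.not_one_one (d := d) ?_ ?_
  · exact (M.kind_mirror (a := two) (b := two) (c := one) (e := tri)).2 h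
  · exact (M.kind_mirror (a := two) (b := two) (c := one) (e := tri)).2 hs

/-- The edges labelled `two, two` join triangles with vertices that are on squares only. -/
theorem TrianglesApart.kind_s_of_two_two_tri (hA : M.TrianglesApart) {d : D}
    (h : M.kind d = (two, two, tri, one)) : M.kind (M.s d) = (two, two, two, two) := by
  have e := M.edge d
  have c := hA.kind_cases (M.s d)
  have n := hA.not_two_two h
  simp only [kind, Prod.mk.injEq, List.mem_cons, List.not_mem_nil] at *
  grind

/-- Going backwards around the square of `d`, the next vertex has all labels `two`, and the
neighbors of such a vertex are known. This fixes the vertex opposite to `d`, and from there the end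
of `d`. -/
theorem kinds_of_two_tri_one_two (hM : M.Transitive) (hA : M.TrianglesApart)
    (hT : ∃ d, M.k d = tri) {d : D} (h : M.kind d = (two, tri, one, two)) :
    M.kind (M.s d) = (tri, one, two, two) ∧
      M.kind (M.s (M.r (M.s d))) = (one, two, two, tri) := by
  have back := M.sq_back d (by simp [M.k_eq h])
  have f := congrArg (fun x => M.r (M.r (M.r x))) back
  simp only [M.r4] at f
  have k3 := hA.kind_s_of_two_two_tri (M.kind_r3 h)
  have k2' := M.kind_r3 k3
  rw [← f] at k2'
  have k2 := kind_s_of_two_two_two hM hA hT k2'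
  rw [M.s2] at k2
  have k1 := M.kind_r3 k2
  rw [M.r4] at k1
  refine ⟨?_, k1⟩
  have e0 := M.edge d
  have e1 := M.edge (M.r (M.s d))
  have c := hA.kind_cases (M.s d)
  simp only [kind, Prod.mk.injEq, List.mem_cons, List.not_mem_nil] at *
  grind

theorem kind_s_of_tri_one_one (hM : M.Transitive) (hA : M.TrianglesApart)
    (hT : ∃ d, M.k d = tri) {d : D} (h : M.kind d = (tri, one, one, two)) :
    M.kind (M.s d) = (two, tri, one, one) := by
  have hT' : ∃ d, M.mirror.k d = tri := by
    obtain ⟨t, ht⟩ := hT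
    exact ⟨M.r (M.r (M.r t)), by simp only [mirror, M.r4, ht, swapLabel]⟩
  have := (kinds_of_two_tri_one_two hM.mirror hA.mirror hT' (d := d)
    ((M.kind_mirror (a := one) (b := tri) (c := two) (e := one)).2 h)).1
  exact (M.kind_mirror (a := tri) (b := two) (c := one) (e := one)).1 this

theorem kind_s_of_tri_one_two_two (hM : M.Transitive) (hA : M.TrianglesApart)
    (hT : ∃ d, M.k d = tri) {d : D} (h : M.kind d = (tri, one, two, two)) :
    M.kind (M.s d) = (two, tri, one, two) := by
  have e := M.edge d
  have c := hA.kind_cases (M.s d)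
  have hs : M.kind (M.s d) = (two, tri, one, two) ∨ M.kind (M.s d) = (two, tri, one, one) := by
    simp only [kind, Prod.mk.injEq, List.mem_cons, List.not_mem_nil] at *
    grind
  rcases hs with hs | hs
  · exact hs
  -- A vertex with labels `one`, `one` passes its kind on around the triangle, back to `d`.
  · have k1 := M.kind_r hs
    have k2 := M.kind_r (kind_s_of_tri_one_one hM hA hT k1)
    have k3 := M.kind_r (kind_s_of_tri_one_one hM hA hT k2)
    rw [M.tri_face d (M.k_eq h), h] at k3
    cases k3

theorem isWorld1_of_tri_one_two_two (hM : M.Transitive) (hA : M.TrianglesApart)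
    {d : D} (h : M.kind d = (tri, one, two, two)) : M.IsWorld1 := by
  have hT : ∃ d, M.k d = tri := ⟨d, M.k_eq h⟩
  have t0 : ∀ {d}, M.kind d = (one, two, two, tri) → M.kind (M.s d) = (one, two, two, tri) := by
    intro d h
    have h0 := M.kind_r3 h
    have h1 := (kinds_of_two_tri_one_two hM hA hT (kind_s_of_tri_one_two_two hM hA hT h0)).2
    rwa [M.s2, M.r4] at h1
  have key : ∀ d, M.kind d = (tri, one, two, two) ∨ M.kind d = (two, tri, one, two) ∨
      M.kind d = (one, two, two, tri) ∨ M.kind d = (two, two, tri, one) ∨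
      M.kind d = (two, two, two, two) := by
    refine hM _ d ?_ ?_ ?_
    · exact .inl h
    · rintro d (h | h | h | h | h) <;> simp [M.kind_r h]
    · rintro d (h | h | h | h | h)
      · simp [kind_s_of_tri_one_two_two hM hA hT h]
      · simp [(kinds_of_two_tri_one_two hM hA hT h).1]
      · simp [t0 h]
      · simp [hA.kind_s_of_two_two_tri h]
      · simp [kind_s_of_two_two_two hM hA hT h]
  intro d
  rcases key d with h | h | h | h | h
  · simp [h, kind_s_of_tri_one_two_two hM hA hT h]
  · simp [h, (kinds_of_two_tri_one_two hM hA hT h).1]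
  · simp [h, t0 h]
  · simp [h, hA.kind_s_of_two_two_tri h]
  · simp [h, kind_s_of_two_two_two hM hA hT h]

theorem isWorld_trichotomy (hM : M.Transitive) (hT : ∃ d, M.k d = tri) :
    M.IsWorld0 ∨ M.IsWorld1 ∨ M.mirror.IsWorld1 := by
  by_cases hA : M.TrianglesApart
  · obtain ⟨t, ht⟩ := hT
    have c := hA.kind_cases t
    have : M.kind t = (tri, one, two, two) ∨ M.kind t = (tri, one, one, two) := by
      simp only [kind, Prod.mk.injEq, List.mem_cons, List.not_mem_nil] at *
      grind
    rcases this with h | h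
    · exact .inr (.inl (isWorld1_of_tri_one_two_two hM hA h))
    · refine .inr (.inr (isWorld1_of_tri_one_two_two hM.mirror hA.mirror (d := M.r (M.r (M.r t))) ?_))
      exact (M.kind_mirror (a := tri) (b := two) (c := one) (e := one)).2 (M.kind_r3 h)
  · left
    simp only [TrianglesApart, not_forall, not_not] at hA
    obtain ⟨d, h, h'⟩ := hA
    exact M.isWorld0_of_tri_tri hM h h'

end LabelledMap

/-! ### From colors to labels. -/

theorem exists_eq_of_nodup_five {a b c d e : Fin 5} (h : [a, b, c, d, e].Nodup) (x : Fin 5) :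
    x = a ∨ x = b ∨ x = c ∨ x = d ∨ x = e := by
  have h1 : [a, b, c, d, e].toFinset = Finset.univ := by
    apply Finset.eq_univ_of_card
    rw [List.toFinset_card_of_nodup h]
    rfl
  have h2 : x ∈ [a, b, c, d, e].toFinset := by simp [h1]
  simpa using h2

/-- Darts of a four-graph with a distance-two five-coloring; `color d` is the color of the vertex
that the dart `d` leaves. -/
structure ColoredMap (D : Type*) where
  r : D → D
  s : D → D
  color : D → Fin 5
  r4 : ∀ d, r (r (r (r d))) = d
  s2 : ∀ d, s (s d) = d
  color_r : ∀ d, color (r d) = color d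
  nodup : ∀ d,
    [color d, color (s d), color (s (r d)), color (s (r (r d))), color (s (r (r (r d))))].Nodup
  face : ∀ d, r (s (r (s (r (s d))))) = d ∨ r (s (r (s (r (s (r (s d))))))) = d

namespace ColoredMap

variable {D : Type*} (M : ColoredMap D)

def labelOf (x a b : Fin 5) : CornerLabel :=
  if x = a then one else if x = b then two else tri

/-- The label of a corner says which of the next two colors around the vertex is the color two
steps further along the face. -/
def label (d : D) : CornerLabel :=
  labelOf (M.color (M.s (M.r (M.s d)))) (M.color (M.s (M.r d))) (M.color (M.s (M.r (M.r d))))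

/-- The color at `d`, followed by the colors of the neighbors in the order of the rotation. -/
def state (d : D) : Fin 5 → Fin 5 :=
  ![M.color d, M.color (M.s d), M.color (M.s (M.r d)), M.color (M.s (M.r (M.r d))),
    M.color (M.s (M.r (M.r (M.r d))))]

theorem state_injective (d : D) : Function.Injective (M.state d) := by
  have h := List.nodup_iff_injective_getElem.1 (M.nodup d)
  intro i j hij
  refine h ?_
  fin_cases i <;> fin_cases j <;> exact hij

theorem state_r (d : D) : M.state (M.r d) = M.state d ∘ ![0, 2, 3, 4, 1] := by
  funext i
  fin_cases i <;> simp [state, M.r4, M.color_r]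

/-- How the neighborhoods of the ends of an edge match, given the labels at one end. -/
def transition : CornerLabel → CornerLabel → Fin 5 → Fin 5
  | one, one => ![1, 0, 2, 4, 3]
  | two, two => ![1, 0, 3, 2, 4]
  | one, two => ![1, 0, 2, 3, 4]
  | tri, one => ![1, 0, 4, 2, 3]
  | two, tri => ![1, 0, 3, 4, 2]
  | _, _ => ![1, 0, 4, 3, 2]

theorem tri_of_eq {d : D} (h : M.color (M.s (M.r (M.s d))) = M.color (M.s (M.r (M.r (M.r d))))) :
    M.r (M.s (M.r (M.s (M.r (M.s d))))) = d := by
  refine (M.face d).resolve_right fun h4 => ?_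
  have h3 := congrArg (fun x => M.s (M.r (M.r (M.r x)))) h4
  simp only [M.r4, M.s2] at h3
  have h5 := M.nodup (M.r (M.s (M.r (M.s d))))
  rw [← h3, M.color_r] at h
  rw [M.color_r] at h5
  simp [h] at h5

theorem sq_of_ne {d : D} (h : M.color (M.s (M.r (M.s d))) ≠ M.color (M.s (M.r (M.r (M.r d))))) :
    M.r (M.s (M.r (M.s (M.r (M.s (M.r (M.s d))))))) = d := by
  refine (M.face d).resolve_left fun h4 => h ?_
  have h3 := congrArg (fun x => M.s (M.r (M.r (M.r x)))) h4
  simp only [M.r4, M.s2] at h3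
  rw [← h3, M.color_r]

theorem color_face_of_eq {d : D}
    (h : M.color (M.s (M.r (M.s d))) = M.color (M.s (M.r (M.r (M.r d))))) :
    M.color (M.s (M.r (M.s (M.r (M.s d))))) = M.color d := by
  rw [← M.color_r, M.tri_of_eq h]

theorem color_face_of_ne {d : D}
    (h : M.color (M.s (M.r (M.s d))) ≠ M.color (M.s (M.r (M.r (M.r d))))) :
    M.color (M.s (M.r (M.s (M.r (M.s d))))) = M.color (M.s (M.r (M.r (M.r d)))) := by
  have h3 := congrArg (fun x => M.s (M.r (M.r (M.r x)))) (M.sq_of_ne h)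
  simp only [M.r4, M.s2] at h3
  rw [← M.color_r, h3]

-- Colors are renamed by their position in the `state` of a dart: 0 its source, 1 its end, 2 to 4
-- the other neighbors of the source. The other neighbors of the end have colors `p`, `q`, `t`, and
-- `x`, `y` are the colors three steps along the two faces at the edge. The six orders of `p`, `q`,
-- `t` are the six cases of `edge`.
set_option synthInstance.maxSize 1000 in
set_option synthInstance.maxHeartbeats 200000 in
theorem edge_labels_aux : ∀ p q t x y : Fin 5, [1, 0, p, q, t].Nodup →
    (p = 4 → x = 0) → (¬p = 4 → x = 4) → (2 = t → y = 1) → (¬2 = t → y = t) →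
    ((labelOf p 2 3 = one ∧ labelOf y 3 4 = one ∧ labelOf 2 p q = one ∧ labelOf x q t = one) ∨
      (labelOf p 2 3 = two ∧ labelOf y 3 4 = two ∧ labelOf 2 p q = two ∧ labelOf x q t = two) ∨
      (labelOf p 2 3 = one ∧ labelOf y 3 4 = two ∧ labelOf 2 p q = one ∧ labelOf x q t = two) ∨
      (labelOf p 2 3 = tri ∧ labelOf y 3 4 = one ∧ labelOf 2 p q = two ∧ labelOf x q t = tri) ∨
      (labelOf p 2 3 = two ∧ labelOf y 3 4 = tri ∧ labelOf 2 p q = tri ∧ labelOf x q t = one) ∨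
      (labelOf p 2 3 = tri ∧ labelOf y 3 4 = tri ∧ labelOf 2 p q = tri ∧ labelOf x q t = tri)) ∧
    ![1, 0, p, q, t] = transition (labelOf p 2 3) (labelOf y 3 4) ∧
    (labelOf p 2 3 = tri ↔ p = 4) := by
  decide +kernel

theorem edge_labels (d : D) :
    ((M.label d = one ∧ M.label (M.r d) = one ∧
        M.label (M.s d) = one ∧ M.label (M.r (M.s d)) = one) ∨
      (M.label d = two ∧ M.label (M.r d) = two ∧
        M.label (M.s d) = two ∧ M.label (M.r (M.s d)) = two) ∨
      (M.label d = one ∧ M.label (M.r d) = two ∧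
        M.label (M.s d) = one ∧ M.label (M.r (M.s d)) = two) ∨
      (M.label d = tri ∧ M.label (M.r d) = one ∧
        M.label (M.s d) = two ∧ M.label (M.r (M.s d)) = tri) ∨
      (M.label d = two ∧ M.label (M.r d) = tri ∧
        M.label (M.s d) = tri ∧ M.label (M.r (M.s d)) = one) ∨
      (M.label d = tri ∧ M.label (M.r d) = tri ∧
        M.label (M.s d) = tri ∧ M.label (M.r (M.s d)) = tri)) ∧
    M.state (M.s d) = M.state d ∘ transition (M.label d) (M.label (M.r d)) ∧
    (M.label d = tri ↔
      M.color (M.s (M.r (M.s d))) = M.color (M.s (M.r (M.r (M.r d))))) := by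
  have inj := M.state_injective d
  have surj := Finite.surjective_of_injective inj
  have n2 := M.nodup (M.s d)
  have x1 := @color_face_of_eq _ M d
  have x2 := @color_face_of_ne _ M d
  have y1 := @color_face_of_eq _ M (M.s d)
  have y2 := @color_face_of_ne _ M (M.s d)
  have s1 : M.state (M.s d) = ![M.color (M.s d), M.color d, M.color (M.s (M.r (M.s d))),
    M.color (M.s (M.r (M.r (M.s d)))), M.color (M.s (M.r (M.r (M.r (M.s d)))))] := by
    simp only [state, M.s2]
  rw [M.s2] at n2 y1 y2
  rw [s1]
  simp only [label, M.s2]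
  have e0 : M.color d = M.state d 0 := rfl
  have e1 : M.color (M.s d) = M.state d 1 := rfl
  have e2 : M.color (M.s (M.r d)) = M.state d 2 := rfl
  have e3 : M.color (M.s (M.r (M.r d))) = M.state d 3 := rfl
  have e4 : M.color (M.s (M.r (M.r (M.r d)))) = M.state d 4 := rfl
  obtain ⟨p, hp⟩ := surj (M.color (M.s (M.r (M.s d))))
  obtain ⟨q, hq⟩ := surj (M.color (M.s (M.r (M.r (M.s d)))))
  obtain ⟨t, ht⟩ := surj (M.color (M.s (M.r (M.r (M.r (M.s d))))))
  obtain ⟨x, hx⟩ := surj (M.color (M.s (M.r (M.s (M.r (M.s d))))))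
  obtain ⟨y, hy⟩ := surj (M.color (M.s (M.r (M.s (M.r d)))))
  rw [← hp, ← hx, e4] at x1 x2
  rw [e0] at x1
  rw [← hy, ← ht, e2] at y1 y2
  rw [e1] at y1
  rw [← hp, ← hq, ← ht, e0, e1] at n2
  rw [e0, e1, e2, e3, e4, ← hp, ← hq, ← ht, ← hx, ← hy]
  generalize M.state d = f at *
  simp only [inj.eq_iff, ne_eq] at x1 x2 y1 y2
  have hl : ∀ i j k, labelOf (f i) (f j) (f k) = labelOf i j k := by
    intro i j k
    simp only [labelOf, inj.eq_iff]
  have hn : [1, 0, p, q, t].Nodup := List.Nodup.of_map f n2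
  have hf : ![f 1, f 0, f p, f q, f t] = f ∘ ![1, 0, p, q, t] := by
    funext i
    fin_cases i <;> rfl
  obtain ⟨c1, c2, c3⟩ := edge_labels_aux p q t x y hn x1 x2 y1 y2
  simp only [hl, inj.eq_iff, hf]
  refine ⟨c1, ?_, c3⟩
  rw [c2]

/-- The corner labels of a colored map. -/
def labelled : LabelledMap D where
  r := M.r
  s := M.s
  k := M.label
  r4 := M.r4
  s2 := M.s2
  tri_face d h := M.tri_of_eq ((M.edge_labels d).2.2.1 h)
  sq_face d h := M.sq_of_ne (fun h' => h ((M.edge_labels d).2.2.2 h'))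
  edge d := (M.edge_labels d).1
  parity d h h' := by
    have h0 := M.edge_labels d
    have h1 := M.edge_labels (M.r (M.s d))
    have h2 := M.edge_labels (M.r (M.s (M.r (M.s d))))
    have h3 := M.edge_labels (M.r (M.r (M.r d)))
    have f := M.tri_of_eq ((M.edge_labels d).2.2.1 h)
    have f' := congrArg (fun x => M.s (M.r (M.r (M.r x)))) f
    simp only [M.r4, M.s2] at f'
    rw [← f', M.r4] at h3
    -- The three transitions around the triangle must compose to the identity. With the labels of
    -- the triangle inserted, a finite check over the three unknown labels leaves exactly the
    -- claimed alternative.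
    have st := congrArg M.state f
    rw [M.state_r, h2.2.1, M.state_r, h1.2.1, M.state_r, h0.2.1] at st
    have st' : ∀ i, (transition (M.label d) (M.label (M.r d)) ∘ ![0, 2, 3, 4, 1] ∘
        transition (M.label (M.r (M.s d))) (M.label (M.r (M.r (M.s d)))) ∘ ![0, 2, 3, 4, 1] ∘
        transition (M.label (M.r (M.s (M.r (M.s d))))) (M.label (M.r (M.r (M.s (M.r (M.s d)))))) ∘
        ![0, 2, 3, 4, 1]) i = i := by
      intro i
      exact M.state_injective d (congrFun st i)
    have a0 := h0.1
    have a1 := h1.1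
    have a2 := h2.1
    have a3 := h3.1
    rw [f'] at a1 a2 a3 st'
    clear h0 h1 h2 h3 st f
    rw [h, h'] at st' a0
    have b1 : M.label (M.r (M.s d)) = tri := by
      revert a0
      simp +contextual
    rw [b1] at a1 st'
    rw [h] at a3
    have b2 : M.label (M.s (M.r (M.r (M.r d)))) = tri := by
      revert a3
      rcases M.label (M.s (M.r (M.r (M.r d)))) <;> simp
    rw [b2] at a1 a3 st'
    revert a1 a3 st'
    generalize M.label (M.r (M.s (M.r (M.r (M.r d))))) = u
    generalize M.label (M.r (M.r (M.s d))) = w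
    generalize M.label (M.r (M.r (M.r d))) = v
    clear * -
    intro st a1 a3
    have s1 := st 1
    have s2 := st 2
    have s3 := st 3
    clear st
    revert a1 a3 s1 s2 s3
    cases u <;> cases v <;> cases w <;> simp [transition]

end ColoredMap

/-! ### Comparison of two colored maps. -/

namespace ColoredMap

variable {D E : Type*} (M : ColoredMap D) (N : ColoredMap E)

theorem label_eq_tri_iff (d : D) :
    M.label d = tri ↔ M.r (M.s (M.r (M.s (M.r (M.s d))))) = d := by
  refine ⟨fun h => M.labelled.tri_face d h, fun h => ?_⟩
  rw [(M.edge_labels d).2.2]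
  have h3 := congrArg (fun x => M.s (M.r (M.r (M.r x)))) h
  simp only [M.r4, M.s2] at h3
  rw [← h3, M.color_r]

/-- The mirror image. -/
def mirror : ColoredMap D where
  r d := M.r (M.r (M.r d))
  s := M.s
  color := M.color
  r4 d := by simp [M.r4]
  s2 := M.s2
  color_r d := by simp [M.color_r]
  nodup d := by
    have h := M.nodup d
    simp only [M.r4]
    simp only [List.nodup_cons, List.mem_cons, List.not_mem_nil, or_false, not_or,
      not_false_eq_true, List.nodup_nil, and_true, eq_comm] at h ⊢
    tauto
  face d := by
    rcases M.face (M.r d) with h1 | h1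
    · left
      have a1 := congrArg (fun x => M.s (M.r (M.r (M.r x)))) h1
      simp only [M.r4, M.s2] at a1
      have a2 := congrArg (fun x => M.s (M.r (M.r (M.r x)))) a1
      simp only [M.r4, M.s2] at a2
      have a3 := congrArg (fun x => M.r (M.r (M.r x))) a2
      simp only [M.r4] at a3
      rw [← a3, M.s2, M.r4]
    · right
      have a1 := congrArg (fun x => M.s (M.r (M.r (M.r x)))) h1
      simp only [M.r4, M.s2] at a1
      have a2 := congrArg (fun x => M.s (M.r (M.r (M.r x)))) a1
      simp only [M.r4, M.s2] at a2
      have a3 := congrArg (fun x => M.s (M.r (M.r (M.r x)))) a2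
      simp only [M.r4, M.s2] at a3
      have a4 := congrArg (fun x => M.r (M.r (M.r x))) a3
      simp only [M.r4] at a4
      rw [← a4, M.s2, M.r4]

theorem mirror_label (d : D) :
    M.mirror.label d = LabelledMap.swapLabel (M.label (M.r d)) := by
  have n1 := M.nodup d
  have n2 := M.nodup (M.s d)
  have y1 := @color_face_of_eq _ M (M.s d)
  have y2 := @color_face_of_ne _ M (M.s d)
  rw [M.s2] at n2 y1 y2
  have ht := exists_eq_of_nodup_five n1 (M.color (M.s (M.r (M.r (M.r (M.s d))))))
  simp only [label, mirror, M.r4]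
  simp only [List.nodup_cons, List.mem_cons, List.not_mem_nil, or_false, not_or, not_false_eq_true,
    List.nodup_nil, and_true] at n1 n2
  simp only [labelOf]
  rcases ht with h | h | h | h | h
  · tauto
  · tauto
  · rw [y1 h.symm, h, if_neg (by tauto), if_neg (by tauto), if_neg (by tauto), if_neg (by tauto)]
    rfl
  · rw [y2 (by rw [h]; tauto), h, if_neg (by tauto), if_pos rfl, if_pos rfl]
    rfl
  · have : M.color (M.s (M.r (M.r d))) ≠ M.color (M.s (M.r (M.r (M.r d)))) := by tauto
    rw [y2 (by rw [h]; tauto), h, if_pos rfl, if_neg this.symm, if_pos rfl]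
    rfl

theorem mirror_labelled : M.mirror.labelled = M.labelled.mirror := by
  have : M.mirror.label = fun d => LabelledMap.swapLabel (M.label (M.r d)) :=
    funext M.mirror_label
  simp only [labelled, LabelledMap.mirror, this, LabelledMap.mk.injEq]
  exact ⟨rfl, rfl, trivial⟩

variable {M N}

/-- The labels around the vertex of a dart determine those at the other end of the edge, in the
same way in both maps. -/
def SameKinds (M : ColoredMap D) (N : ColoredMap E) : Prop :=
  ∀ d x, M.labelled.kind d = N.labelled.kind x →
    M.labelled.kind (M.s d) = N.labelled.kind (N.s x)

theorem sameKinds_of_isWorld0 (hM : M.labelled.IsWorld0) (hN : N.labelled.IsWorld0) :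
    SameKinds M N := by
  intro d x h
  rcases hM d with h1 | h1 | h1 | h1 | h1 <;> rcases hN x with h2 | h2 | h2 | h2 | h2 <;>
    first
    | exact h1.2.trans h2.2.symm
    | (rw [h1.1, h2.1] at h; simp at h)

theorem sameKinds_of_isWorld1 (hM : M.labelled.IsWorld1) (hN : N.labelled.IsWorld1) :
    SameKinds M N := by
  intro d x h
  rcases hM d with h1 | h1 | h1 | h1 | h1 <;> rcases hN x with h2 | h2 | h2 | h2 | h2 <;>
    first
    | exact h1.2.trans h2.2.symm
    | (rw [h1.1, h2.1] at h; simp at h)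

/-- The neighborhoods of `d` and `x` look the same, up to the permutation `π` of the colors. -/
def Alike (M : ColoredMap D) (N : ColoredMap E) (π : Equiv.Perm (Fin 5)) (d : D) (x : E) : Prop :=
  M.labelled.kind d = N.labelled.kind x ∧ M.state d = π ∘ N.state x

theorem exists_alike {d : D} {x : E} (h : M.labelled.kind d = N.labelled.kind x) :
    ∃ π, Alike M N π d x := by
  let a := Equiv.ofBijective _ (Finite.injective_iff_bijective.1 (M.state_injective d))
  let b := Equiv.ofBijective _ (Finite.injective_iff_bijective.1 (N.state_injective x))
  refine ⟨b.symm.trans a, h, ?_⟩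
  funext i
  have : b.symm (N.state x i) = i := b.symm_apply_apply i
  simp only [Function.comp, Equiv.trans_apply, this]
  rfl

theorem Alike.r {π : Equiv.Perm (Fin 5)} {d : D} {x : E} (h : Alike M N π d x) :
    Alike M N π (M.r d) (N.r x) := by
  refine ⟨?_, ?_⟩
  · exact (M.labelled.kind_r (d := d) (h.1.trans rfl)).trans (N.labelled.kind_r (d := x) rfl).symm
  · rw [M.state_r, N.state_r, h.2]
    rfl

theorem Alike.s (hs : SameKinds M N) {π : Equiv.Perm (Fin 5)} {d : D} {x : E}
    (h : Alike M N π d x) : Alike M N π (M.s d) (N.s x) := by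
  refine ⟨hs d x h.1, ?_⟩
  have h1 := h.1
  simp only [LabelledMap.kind, Prod.mk.injEq] at h1
  rw [(M.edge_labels d).2.1, (N.edge_labels x).2.1, h.2, show M.label d = N.label x from h1.1,
    show M.label (M.r d) = N.label (N.r x) from h1.2.1]
  rfl

theorem color_eq_of_alike {M N : ColoredMap D} (hN : N.labelled.Transitive) (hr : M.r = N.r)
    (hs' : M.s = N.s) (hs : SameKinds M N) {π : Equiv.Perm (Fin 5)} {d : D}
    (h : Alike M N π d d) (x : D) : M.color x = π (N.color x) := by
  have : Alike M N π x x := by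
    refine hN (fun x => Alike M N π x x) d h (fun d hd => ?_) (fun d hd => ?_) x
    · have := hd.r
      rwa [hr] at this
    · have := hd.s hs
      rwa [hs'] at this
  exact congrFun this.2 0

/-- The permutation `π` found at the base dart stays fixed during the continuation. Injectivity of
`N.state` makes the image of each dart independent of the path taken. -/
theorem exists_hom (hM : M.labelled.Transitive) (hs : SameKinds M N)
    (hN : Function.Injective N.state) {d₀ : D} {x₀ : E}
    (h₀ : M.labelled.kind d₀ = N.labelled.kind x₀) :
    ∃ f : D → E, (∀ d, f (M.r d) = N.r (f d)) ∧ (∀ d, f (M.s d) = N.s (f d)) ∧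
      ∀ d, M.label d = N.label (f d) := by
  obtain ⟨π, hπ⟩ := exists_alike h₀
  have key : ∀ d, ∃ x, Alike M N π d x :=
    hM _ d₀ ⟨x₀, hπ⟩ (fun d ⟨x, hx⟩ => ⟨N.r x, hx.r⟩) (fun d ⟨x, hx⟩ => ⟨N.s x, hx.s hs⟩)
  have uniq : ∀ d x y, Alike M N π d x → Alike M N π d y → x = y := by
    intro d x y hx hy
    refine hN (funext fun i => π.injective ?_)
    exact congrFun (hx.2.symm.trans hy.2) i
  choose f hf using key
  refine ⟨f, fun d => uniq _ _ _ (hf _) (hf d).r, fun d => uniq _ _ _ (hf _) ((hf d).s hs),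
    fun d => ?_⟩
  have := (hf d).1
  simp only [LabelledMap.kind, Prod.mk.injEq] at this
  exact this.1

/-- A homomorphism between maps with the same number of corners in triangles is bijective. -/
theorem bijective_of_card [Finite D] [Finite E] (hE : N.labelled.Transitive) {n : ℕ} (hn : 0 < n)
    (hD : Nat.card {d // M.label d = tri} = n) (hE' : Nat.card {x // N.label x = tri} = n)
    (f : D → E) (fr : ∀ d, f (M.r d) = N.r (f d)) (fs : ∀ d, f (M.s d) = N.s (f d))
    (fl : ∀ d, M.label d = N.label (f d)) : Function.Bijective f := by
  have : Nonempty {d // M.label d = tri} := by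
    rw [← hD] at hn
    exact (Nat.card_pos_iff.1 hn).1
  obtain ⟨t, ht⟩ := this
  have surj : Function.Surjective f :=
    hE (fun x => ∃ d, f d = x) (f t) ⟨t, rfl⟩ (fun x ⟨d, hd⟩ => ⟨M.r d, by rw [fr, hd]; rfl⟩)
      (fun x ⟨d, hd⟩ => ⟨M.s d, by rw [fs, hd]; rfl⟩)
  let g : {d // M.label d = tri} → {x // N.label x = tri} :=
    fun d => ⟨f d.1, by rw [← fl]; exact d.2⟩
  have gsurj : Function.Surjective g := by
    rintro ⟨x, hx⟩
    obtain ⟨d, rfl⟩ := surj x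
    exact ⟨⟨d, by rw [fl]; exact hx⟩, rfl⟩
  have ginj : Function.Injective g :=
    ((Nat.bijective_iff_surjective_and_card g).2 ⟨gsurj, hD.trans hE'.symm⟩).1
  refine ⟨?_, surj⟩
  -- The fiber over `f t` is a single dart by the count of triangle corners; `r` and `s` carry
  -- fibers bijectively to fibers.
  have key : ∀ x, ∀ d d', f d = x → f d' = x → d = d' := by
    refine hE _ (f t) ?_ ?_ ?_
    · intro d d' h h'
      have e : M.label d = tri := by rw [fl, h, ← fl, ht]
      have e' : M.label d' = tri := by rw [fl, h', ← fl, ht]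
      exact congrArg Subtype.val (@ginj ⟨d, e⟩ ⟨d', e'⟩ (Subtype.ext (h.trans h'.symm)))
    · intro x hx d d' h h'
      have h3 : ∀ d, f d = N.r x → f (M.r (M.r (M.r d))) = x := by
        intro d h
        rw [fr, fr, fr, h, N.r4]
      have := hx _ _ (h3 d h) (h3 d' h')
      have := congrArg M.r this
      rwa [M.r4, M.r4] at this
    · intro x hx d d' h h'
      have h3 : ∀ d, f d = N.s x → f (M.s d) = x := by
        intro d h
        rw [fs, h, N.s2]
      have := congrArg M.s (hx _ _ (h3 d h) (h3 d' h'))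
      rwa [M.s2, M.s2] at this
  exact fun d d' h => key _ d d' h rfl

end ColoredMap

/-! ### Counting faces with Euler's formula. -/

open Function in
theorem Equiv.Perm.card_sameCycle {α : Type*} [Finite α] (f : Equiv.Perm α) (x : α) :
    Nat.card {y // f.SameCycle x y} = minimalPeriod f x := by
  have hx : x ∈ periodicPts f := f.injective.mem_periodicPts x
  have hpos := minimalPeriod_pos_of_mem_periodicPts hx
  let g : Fin (minimalPeriod f x) → {y // f.SameCycle x y} :=
    fun i => ⟨f^[i] x, i, by simp [Equiv.Perm.iterate_eq_pow]⟩
  have hg : Function.Bijective g := by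
    constructor
    · intro i j h
      exact Fin.ext (iterate_injOn_Iio_minimalPeriod i.2 j.2 (congrArg Subtype.val h))
    · rintro ⟨y, hy⟩
      obtain ⟨n, hn⟩ := hy.exists_nat_pow_eq
      refine ⟨⟨n % minimalPeriod f x, Nat.mod_lt _ hpos⟩, Subtype.ext ?_⟩
      simp only [g]
      rw [iterate_mod_minimalPeriod_eq, Equiv.Perm.iterate_eq_pow, hn]
  rw [← Nat.card_eq_of_bijective g hg, Nat.card_eq_fintype_card, Fintype.card_fin]

/-- If all classes of an equivalence relation have three or four elements, the number of classes
is determined by the number of elements in either kind of class. -/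
theorem Setoid.twelve_mul_card_quotient {α : Type*} [Finite α] (S : Setoid α)
    (h : ∀ a, Nat.card {b // S a b} = 3 ∨ Nat.card {b // S a b} = 4) :
    12 * Nat.card (Quotient S) =
      3 * Nat.card α + Nat.card {a // Nat.card {b // S a b} = 3} := by
  classical
  have := Fintype.ofFinite α
  -- Elements of a class of three weigh 4 and those of a class of four weigh 3, so every class
  -- weighs 12.
  have hsum : ∀ q : Quotient S, ∑ a : α with Quotient.mk S a = q,
      (if Nat.card {b // S a b} = 3 then 4 else 3) = 12 := by
    intro q
    obtain ⟨a, rfl⟩ := Quotient.exists_rep q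
    have e : ∀ b ∈ Finset.univ.filter (fun b => Quotient.mk S b = Quotient.mk S a),
        (if Nat.card {c // S b c} = 3 then 4 else 3) =
          if Nat.card {c // S a c} = 3 then 4 else 3 := by
      intro b hb
      have hb' : S b a := Quotient.exact (Finset.mem_filter.1 hb).2
      have : Nat.card {c // S b c} = Nat.card {c // S a c} := by
        congr 1
        congr 1
        funext c
        exact propext ⟨fun h => S.trans (S.symm hb') h, fun h => S.trans hb' h⟩
      rw [this]
    rw [Finset.sum_congr rfl e, Finset.sum_const]
    have c : (Finset.univ.filter (fun b => Quotient.mk S b = Quotient.mk S a)).card =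
        Nat.card {c // S a c} := by
      rw [Nat.card_eq_fintype_card, Fintype.card_subtype]
      congr 1
      ext b
      simp only [Finset.mem_filter, Finset.mem_univ, true_and]
      exact ⟨fun h => S.symm (Quotient.exact h), fun h => Quotient.sound (S.symm h)⟩
    rw [c]
    rcases h a with h | h <;> rw [h] <;> rfl
  have total := Finset.sum_fiberwise (Finset.univ : Finset α) (fun a => Quotient.mk S a)
    (fun a => if Nat.card {b // S a b} = 3 then 4 else 3)
  rw [Finset.sum_congr rfl (fun q _ => hsum q), Finset.sum_const] at total
  have split : ∀ a : α, (if Nat.card {b // S a b} = 3 then 4 else 3) =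
      3 + if Nat.card {b // S a b} = 3 then 1 else 0 := by
    intro a; split_ifs <;> rfl
  rw [Finset.sum_congr rfl (fun a _ => split a), Finset.sum_add_distrib, Finset.sum_const,
    Finset.sum_boole] at total
  rw [Nat.card_eq_fintype_card, Nat.card_eq_fintype_card, Nat.card_eq_fintype_card,
    Fintype.card_subtype]
  simp only [Finset.card_univ, smul_eq_mul, Nat.cast_id] at total
  omega

namespace SimpleGraph

variable {V : Type*} {G : SimpleGraph V}

instance [Finite V] : Finite G.Dart := Finite.of_injective _ Dart.toProd_injective

theorem card_dart_of_four_regular [Finite V] (h : ∀ v, (G.neighborSet v).ncard = 4) :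
    Nat.card G.Dart = 4 * Nat.card V ∧ Nat.card G.edgeSet = 2 * Nat.card V := by
  classical
  have := Fintype.ofFinite V
  have h1 := G.dart_card_eq_sum_degrees
  have h2 := G.dart_card_eq_twice_card_edges
  have h3 : ∀ v, G.degree v = 4 := by
    intro v
    rw [← h v, Set.ncard_eq_toFinset_card']
    rfl
  simp only [h3, Finset.sum_const, Finset.card_univ, smul_eq_mul] at h1
  have h4 : Nat.card G.edgeSet = G.edgeFinset.card := by
    rw [Nat.card_eq_fintype_card, SimpleGraph.edgeFinset_card]
  rw [Nat.card_eq_fintype_card, Nat.card_eq_fintype_card, h4]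
  omega

theorem Preconnected.card_connectedComponent (h : G.Preconnected) [Nonempty V] :
    Nat.card G.ConnectedComponent = 1 := by
  have := h.subsingleton_connectedComponent
  have : Nonempty G.ConnectedComponent := ⟨G.connectedComponentMk (Classical.arbitrary V)⟩
  exact Nat.card_unique

/-- The permutation that leads from one dart to the next along a facial walk. -/
def facial (rot : Equiv.Perm G.Dart) : Equiv.Perm G.Dart :=
  (Function.Involutive.toPerm _ Dart.symm_involutive).trans rot

theorem facial_apply (rot : Equiv.Perm G.Dart) (d : G.Dart) : facial rot d = rot d.symm := rfl

/-- Rotations around the vertices of a graph with all degrees four. -/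
structure IsRotation (rot : Equiv.Perm G.Dart) : Prop where
  fst : ∀ d : G.Dart, (rot d).fst = d.fst
  cyclic : ∀ d e : G.Dart, d.fst = e.fst → rot.SameCycle d e
  degree : ∀ v : V, (G.neighborSet v).ncard = 4

theorem Preconnected.dart_induction (hG : G.Preconnected) {rot : Equiv.Perm G.Dart}
    (hc : ∀ d e : G.Dart, d.fst = e.fst → rot.SameCycle d e) [Finite V] (p : G.Dart → Prop)
    (d₀ : G.Dart) (h₀ : p d₀) (hr : ∀ d, p d → p (rot d)) (hs : ∀ d, p d → p d.symm) (d : G.Dart) :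
    p d := by
  have hfst : ∀ d e : G.Dart, p d → d.fst = e.fst → p e := by
    intro d e hd h
    obtain ⟨n, rfl⟩ := (hc d e h).exists_nat_pow_eq
    clear h
    induction n with
    | zero => exact hd
    | succ n ih =>
      rw [pow_succ', Equiv.Perm.mul_apply]
      exact hr _ ih
  have hadj : ∀ u v, G.Reachable u v → (∀ e : G.Dart, e.fst = u → p e) →
      ∀ e : G.Dart, e.fst = v → p e := by
    rintro u v ⟨w⟩
    induction w with
    | nil => exact id
    | cons h _ ih =>
      intro hu
      exact ih fun e he => hfst _ e (hs _ (hu ⟨(_, _), h⟩ rfl)) he.symm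
  exact hadj _ _ (hG d₀.fst d.fst) (fun e he => hfst _ e h₀ he.symm) d rfl

namespace IsRotation

variable {rot : Equiv.Perm G.Dart} (h : IsRotation rot)

include h

theorem minimalPeriod [Finite V] (d : G.Dart) : Function.minimalPeriod rot d = 4 := by
  rw [← Equiv.Perm.card_sameCycle, ← h.degree d.fst, ← Nat.card_coe_set_eq]
  have key : ∀ e, rot.SameCycle d e → e.fst = d.fst := by
    intro e he
    obtain ⟨n, rfl⟩ := he.exists_nat_pow_eq
    clear he
    induction n with
    | zero => rfl
    | succ n ih => rw [pow_succ', Equiv.Perm.mul_apply, h.fst, ih]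
  refine Nat.card_congr
    { toFun := fun e => ⟨e.1.snd, key e.1 e.2 ▸ e.1.adj⟩
      invFun := fun w => ⟨⟨(d.fst, w.1), w.2⟩, h.cyclic _ _ rfl⟩
      left_inv := ?_
      right_inv := fun w => rfl }
  rintro ⟨e, he⟩
  exact Subtype.ext (Dart.ext _ _ (Prod.ext (key e he).symm rfl))

theorem rot_four [Finite V] (d : G.Dart) : rot (rot (rot (rot d))) = d := by
  have := Function.iterate_minimalPeriod (f := rot) (x := d)
  rwa [h.minimalPeriod] at this

theorem rot_ne [Finite V] (d : G.Dart) :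
    rot d ≠ d ∧ rot (rot d) ≠ d ∧ rot (rot (rot d)) ≠ d := by
  have inj := Function.iterate_injOn_Iio_minimalPeriod (f := rot) (x := d)
  rw [h.minimalPeriod] at inj
  refine ⟨fun e => ?_, fun e => ?_, fun e => ?_⟩
  · exact absurd (@inj 1 (by simp) 0 (by simp) e) (by simp)
  · exact absurd (@inj 2 (by simp) 0 (by simp) e) (by simp)
  · exact absurd (@inj 3 (by simp) 0 (by simp) e) (by simp)

theorem facial_ne [Finite V] (d : G.Dart) :
    facial rot d ≠ d ∧ facial rot (facial rot d) ≠ d := by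
  constructor
  · intro e
    have := congrArg (fun e : G.Dart => e.fst) e
    simp only [facial_apply, h.fst] at this
    exact d.snd_ne_fst this
  · intro e
    refine (h.rot_ne d.symm).1 ?_
    have h1 := congrArg (fun e : G.Dart => e.fst) e
    simp only [facial_apply, h.fst] at h1
    exact Dart.ext _ _ (Prod.ext (h.fst _) h1)

/-- A facial walk of length one would be a loop; one of length two would, in a simple graph, make
`rot` fix a dart. -/
theorem three_le_minimalPeriod_facial [Finite V] (d : G.Dart) :
    3 ≤ Function.minimalPeriod (facial rot) d := by
  have pos := Function.minimalPeriod_pos_of_mem_periodicPts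
    ((facial rot).injective.mem_periodicPts d)
  have it := Function.iterate_minimalPeriod (f := facial rot) (x := d)
  by_contra! hlt
  obtain e | e : Function.minimalPeriod (facial rot) d = 1 ∨
      Function.minimalPeriod (facial rot) d = 2 := by omega
  · rw [e] at it
    exact (h.facial_ne d).1 it
  · rw [e] at it
    exact (h.facial_ne d).2 it

/-- The number of darts on facial walks of length three, in terms of Euler's formula. -/
theorem euler_iff [Finite V]
    (hface : ∀ d, Function.minimalPeriod (facial rot) d = 3 ∨
      Function.minimalPeriod (facial rot) d = 4)
    (S : Setoid G.Dart) (hS : ∀ d e, S d e ↔ (facial rot).SameCycle d e) :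
    Nat.card V + Nat.card (Quotient S) = 1 + 1 + Nat.card G.edgeSet ↔
      Nat.card {d // Function.minimalPeriod (facial rot) d = 3} = 24 := by
  have hcard : ∀ d, Nat.card {e // S d e} = Function.minimalPeriod (facial rot) d := by
    intro d
    rw [← Equiv.Perm.card_sameCycle]
    simp only [hS]
  have := S.twelve_mul_card_quotient (by simpa only [hcard] using hface)
  simp only [hcard] at this
  -- With `E = 2V` and `4V` darts, `T` of them on triangles, the count reads `12F = 12V + T`, while
  -- Euler's formula reads `F = V + 2`.
  have := card_dart_of_four_regular h.degree
  omega

theorem nodup_color [Finite V] {c : V → Fin 5} (hc : IsDistanceTwoColoring G c) (d : G.Dart) :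
    [c d.fst, c d.snd, c (rot d).snd, c (rot (rot d)).snd, c (rot (rot (rot d))).snd].Nodup := by
  have hne := h.rot_ne
  have hd : ∀ d e : G.Dart, d.fst = e.fst → d ≠ e → c d.snd ≠ c e.snd := by
    intro d e h1 h2 h3
    refine h2 (Dart.ext _ _ (Prod.ext h1 ?_))
    exact hc d.fst (.inr d.adj) (.inr (h1 ▸ e.adj)) h3
  have hf : ∀ d e : G.Dart, d.fst = e.fst → c d.fst ≠ c e.snd := by
    intro d e h1 h3
    have := hc d.fst (.inl rfl) (.inr (h1 ▸ e.adj)) h3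
    exact e.fst_ne_snd (h1.symm.trans this)
  have r4 := h.rot_four d
  have i0 := hne d
  have i1 := hne (rot d)
  have i2 := hne (rot (rot d))
  simp only [List.nodup_cons, List.mem_cons, List.not_mem_nil, or_false, not_or, not_false_eq_true,
    List.nodup_nil, and_true]
  refine ⟨⟨?_, ?_, ?_, ?_⟩, ⟨?_, ?_, ?_⟩, ⟨?_, ?_⟩, ?_⟩
  · exact hf _ _ rfl
  · exact hf _ _ (by simp [h.fst])
  · exact hf _ _ (by simp [h.fst])
  · exact hf _ _ (by simp [h.fst])
  · exact hd _ _ (by simp [h.fst]) i0.1.symm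
  · exact hd _ _ (by simp [h.fst]) i0.2.1.symm
  · exact hd _ _ (by simp [h.fst]) i0.2.2.symm
  · exact hd _ _ (by simp [h.fst]) i1.1.symm
  · exact hd _ _ (by simp [h.fst]) i1.2.1.symm
  · exact hd _ _ (by simp [h.fst]) i2.1.symm

end IsRotation
end SimpleGraph

/-! ### Four-graphs as colored maps. -/

namespace PlaneEmbedding
open SimpleGraph

variable {V : Type*} [Finite V] {G : SimpleGraph V} {P : PlaneEmbedding G}

theorem nonempty (P : PlaneEmbedding G) : Nonempty V := by
  by_contra hV
  rw [not_nonempty_iff] at hV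
  have := P.euler
  have : IsEmpty (Quotient P.face) := ⟨fun q => q.exists_rep.elim fun d _ => hV.elim d.fst⟩
  simp at *

namespace IsFourGraph

variable (hP : P.IsFourGraph)
include hP

theorem isRotation : IsRotation P.rot := ⟨P.rot_fst, P.rot_cyclic, hP.1⟩

/-- Two facial walks in one face would contribute at least six darts, but a face has at most four.
-/
theorem face_iff (d e : G.Dart) : P.face d e ↔ (facial P.rot).SameCycle d e := by
  classical
  have sub : ∀ d e, (facial P.rot).SameCycle d e → P.face d e := by
    intro d e h
    obtain ⟨n, rfl⟩ := h.exists_nat_pow_eq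
    clear h
    induction n with
    | zero => exact P.face.refl _
    | succ n ih =>
      rw [pow_succ', Equiv.Perm.mul_apply]
      exact P.face.trans ih (P.face_next _)
  refine ⟨fun h => ?_, sub d e⟩
  by_contra hne
  have c1 := hP.isRotation.three_le_minimalPeriod_facial d
  have c2 := hP.isRotation.three_le_minimalPeriod_facial e
  rw [← Equiv.Perm.card_sameCycle] at c1 c2
  let g : {x // (facial P.rot).SameCycle d x} ⊕ {x // (facial P.rot).SameCycle e x} →
      {x // P.face d x} :=
    Sum.elim (fun x => ⟨x.1, sub _ _ x.2⟩) (fun x => ⟨x.1, P.face.trans h (sub _ _ x.2)⟩)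
  have hg : Function.Injective g := by
    rintro (⟨x, hx⟩ | ⟨x, hx⟩) (⟨y, hy⟩ | ⟨y, hy⟩) hxy <;>
      obtain rfl : x = y := congrArg Subtype.val hxy
    · rfl
    · exact absurd (hx.trans hy.symm) hne
    · exact absurd (hy.trans hx.symm) hne
    · rfl
  have := Nat.card_le_card_of_injective g hg
  rw [Nat.card_sum] at this
  have h4 : Nat.card {x // P.face d x} = 3 ∨ Nat.card {x // P.face d x} = 4 := hP.2 d
  omega

theorem minimalPeriod_facial (d : G.Dart) :
    Function.minimalPeriod (facial P.rot) d = 3 ∨ Function.minimalPeriod (facial P.rot) d = 4 := by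
  rw [← Equiv.Perm.card_sameCycle]
  simp only [← hP.face_iff]
  exact hP.2 d

/-- A face is a single facial walk, so passing through a face never leaves a component of the graph.
-/
theorem preconnected : G.Preconnected := by
  have hwalk : ∀ d e : G.Dart, P.face d e → G.Reachable d.fst e.fst := by
    intro d e h
    obtain ⟨n, rfl⟩ := ((hP.face_iff d e).1 h).exists_nat_pow_eq
    clear h
    induction n with
    | zero => exact .refl _
    | succ n ih =>
      rw [pow_succ', Equiv.Perm.mul_apply]
      refine ih.trans (SimpleGraph.Adj.reachable ?_)
      rw [facial_apply, P.rot_fst]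
      exact Dart.adj _
  intro u v
  have := P.sphere_connected u v
  induction this with
  | rel u v h =>
    rcases h with h | ⟨d, e, rfl, rfl, h⟩
    · exact h.reachable
    · exact hwalk d e h
  | refl => exact .refl _
  | symm _ _ _ ih => exact ih.symm
  | trans _ _ _ _ _ ih ih' => exact ih.trans ih'

theorem card_triangle_darts :
    Nat.card {d // Function.minimalPeriod (facial P.rot) d = 3} = 24 := by
  have := P.nonempty
  refine (hP.isRotation.euler_iff hP.minimalPeriod_facial P.face hP.face_iff).1 ?_
  rw [P.euler, hP.preconnected.card_connectedComponent]

omit hP in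
/-- A four-graph with a distance-two five-coloring as a colored map. -/
def colored (hP : P.IsFourGraph) {c : V → Fin 5} (hc : IsDistanceTwoColoring G c) :
    ColoredMap G.Dart where
  r := P.rot
  s := Dart.symm
  color d := c d.fst
  r4 := hP.isRotation.rot_four
  s2 := Dart.symm_symm
  color_r d := by rw [P.rot_fst]
  nodup := hP.isRotation.nodup_color hc
  face d := by
    have it := Function.iterate_minimalPeriod (f := facial P.rot) (x := d)
    rcases hP.minimalPeriod_facial d with h | h <;> rw [h] at it
    · exact .inl it
    · exact .inr it

variable {c : V → Fin 5} (hc : IsDistanceTwoColoring G c)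

theorem label_eq_tri_iff (d : G.Dart) : (hP.colored hc).label d = .tri ↔
    Function.minimalPeriod (facial P.rot) d = 3 := by
  rw [ColoredMap.label_eq_tri_iff]
  constructor
  · intro h
    refine (hP.minimalPeriod_facial d).resolve_right fun h4 => ?_
    have := Function.IsPeriodicPt.minimalPeriod_le (f := facial P.rot) (n := 3) (x := d)
      (by simp) h
    omega
  · intro h
    have it := Function.iterate_minimalPeriod (f := facial P.rot) (x := d)
    rw [h] at it
    exact it

theorem card_tri : Nat.card {d // (hP.colored hc).label d = .tri} = 24 := by
  simp only [hP.label_eq_tri_iff]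
  exact hP.card_triangle_darts

theorem exists_tri : ∃ d, (hP.colored hc).label d = .tri := by
  have := hP.card_tri hc
  obtain ⟨d, hd⟩ := (Nat.card_pos_iff.1 (this ▸ (by simp : 0 < 24))).1
  exact ⟨d, hd⟩

theorem transitive : (hP.colored hc).labelled.Transitive :=
  fun p d₀ h₀ hr hs => hP.preconnected.dart_induction P.rot_cyclic p d₀ h₀ hr hs

end IsFourGraph
end PlaneEmbedding

/-! ### Spherical embeddings from lists of neighbors. -/

namespace SimpleGraph

/-- A rotation system on a graph with all degrees four: `nbr v` lists the neighbors of `v` in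
cyclic order. -/
structure RotationList {V : Type*} (G : SimpleGraph V) where
  nbr : V → Fin 4 → V
  inj : ∀ v, Function.Injective (nbr v)
  adj_iff : ∀ v w, G.Adj v w ↔ ∃ i, nbr v i = w

namespace RotationList

variable {V : Type*} {G : SimpleGraph V} (R : RotationList G)

noncomputable def dartEquiv : V × Fin 4 ≃ G.Dart :=
  Equiv.ofBijective (fun x => ⟨(x.1, R.nbr x.1 x.2), (R.adj_iff _ _).2 ⟨x.2, rfl⟩⟩) <| by
    constructor
    · rintro ⟨v, i⟩ ⟨w, j⟩ h
      have h1 : v = w := congrArg (fun d : G.Dart => d.fst) h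
      subst h1
      have h2 : R.nbr v i = R.nbr v j := congrArg (fun d : G.Dart => d.snd) h
      rw [R.inj v h2]
    · rintro ⟨⟨v, w⟩, h⟩
      obtain ⟨i, hi⟩ := (R.adj_iff v w).1 h
      exact ⟨(v, i), Dart.ext _ _ (Prod.ext rfl hi)⟩

noncomputable def rot : Equiv.Perm G.Dart :=
  (R.dartEquiv.symm.trans ((Equiv.refl V).prodCongr (Equiv.addRight 1))).trans R.dartEquiv

theorem rot_dartEquiv (x : V × Fin 4) : R.rot (R.dartEquiv x) = R.dartEquiv (x.1, x.2 + 1) := by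
  simp [rot, Prod.map]

theorem fst_dartEquiv (x : V × Fin 4) : (R.dartEquiv x).fst = x.1 := rfl

theorem isRotation : IsRotation R.rot where
  fst d := by
    obtain ⟨x, rfl⟩ := R.dartEquiv.surjective d
    rw [rot_dartEquiv, fst_dartEquiv, fst_dartEquiv]
  cyclic d e h := by
    obtain ⟨⟨v, i⟩, rfl⟩ := R.dartEquiv.surjective d
    obtain ⟨⟨w, j⟩, rfl⟩ := R.dartEquiv.surjective e
    obtain rfl : v = w := h
    open Fin.NatCast in
    have key : ∀ n : ℕ, (R.rot ^ n) (R.dartEquiv (v, i)) = R.dartEquiv (v, i + (n : Fin 4)) := by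
      intro n
      induction n with
      | zero => simp
      | succ n ih =>
        rw [pow_succ', Equiv.Perm.mul_apply, ih, rot_dartEquiv]
        simp [add_assoc]
    refine ⟨((j - i : Fin 4) : ℕ), ?_⟩
    rw [zpow_natCast, key, Fin.cast_val_eq_self, add_sub_cancel]
  degree v := by
    have : G.neighborSet v = Set.range (R.nbr v) := by
      ext w
      exact R.adj_iff v w
    rw [this, ← Set.image_univ, Set.ncard_image_of_injective _ (R.inj v), Set.ncard_univ,
      Nat.card_eq_fintype_card, Fintype.card_fin]

theorem preconnected (height : V → ℕ) (root : V)
    (h : ∀ v, v = root ∨ ∃ i, height (R.nbr v i) < height v) : G.Preconnected := by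
  have key : ∀ n v, height v < n → G.Reachable v root := by
    intro n
    induction n with
    | zero => intro v hv; omega
    | succ n ih =>
      intro v hv
      rcases h v with rfl | ⟨i, hi⟩
      · exact .refl _
      · exact ((R.adj_iff _ _).2 ⟨i, rfl⟩ : G.Adj v _).reachable.trans (ih _ (by omega))
  exact fun u v => (key _ u (Nat.lt_succ_self _)).trans (key _ v (Nat.lt_succ_self _)).symm

variable [DecidableEq V]

/-- The position of `v` in the list of the neighbors of its neighbor number `i`. -/
def back (nbr : V → Fin 4 → V) (x : V × Fin 4) : Fin 4 :=
  if nbr (nbr x.1 x.2) 0 = x.1 then 0 else if nbr (nbr x.1 x.2) 1 = x.1 then 1 else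
    if nbr (nbr x.1 x.2) 2 = x.1 then 2 else 3

/-- The next dart of a facial walk. -/
def next (nbr : V → Fin 4 → V) (x : V × Fin 4) : V × Fin 4 := (nbr x.1 x.2, back nbr x + 1)

theorem symm_dartEquiv (x : V × Fin 4) :
    (R.dartEquiv x).symm = R.dartEquiv (R.nbr x.1 x.2, back R.nbr x) := by
  refine Dart.ext _ _ (Prod.ext rfl ?_)
  change x.1 = R.nbr (R.nbr x.1 x.2) (back R.nbr x)
  -- By symmetry of adjacency some position exists, so the default value 3 in `back` is right when
  -- 0, 1 and 2 fail.
  obtain ⟨i, hi⟩ := (R.adj_iff _ _).1 ((R.adj_iff x.1 _).2 ⟨x.2, rfl⟩).symm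
  unfold back
  split_ifs with h0 h1 h2
  · exact h0.symm
  · exact h1.symm
  · exact h2.symm
  · fin_cases i
    · exact absurd hi h0
    · exact absurd hi h1
    · exact absurd hi h2
    · exact hi.symm

theorem facial_dartEquiv (x : V × Fin 4) :
    facial R.rot (R.dartEquiv x) = R.dartEquiv (next R.nbr x) := by
  rw [facial_apply, symm_dartEquiv, rot_dartEquiv, next]

variable [Finite V]

/-- The facial walks have length three or four, with the right number of triangles for a
sphere. -/
structure IsSpherical : Prop where
  face : ∀ x, next R.nbr (next R.nbr (next R.nbr x)) = x ∨
    next R.nbr (next R.nbr (next R.nbr (next R.nbr x))) = x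
  card : Nat.card {x // next R.nbr (next R.nbr (next R.nbr x)) = x} = 24
  preconnected : G.Preconnected

variable {R} (hR : R.IsSpherical)
include hR

theorem IsSpherical.minimalPeriod (d : G.Dart) :
    Function.minimalPeriod (facial R.rot) d = 3 ∨
      Function.minimalPeriod (facial R.rot) d = 4 := by
  have h3 := R.isRotation.three_le_minimalPeriod_facial d
  obtain ⟨x, rfl⟩ := R.dartEquiv.surjective d
  rcases hR.face x with h | h
  · have : Function.minimalPeriod (facial R.rot) (R.dartEquiv x) ≤ 3 := by
      refine Function.IsPeriodicPt.minimalPeriod_le (by simp) ?_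
      change facial R.rot (facial R.rot (facial R.rot (R.dartEquiv x))) = _
      simp only [facial_dartEquiv, h]
    omega
  · have : Function.minimalPeriod (facial R.rot) (R.dartEquiv x) ≤ 4 := by
      refine Function.IsPeriodicPt.minimalPeriod_le (by simp) ?_
      change facial R.rot (facial R.rot (facial R.rot (facial R.rot (R.dartEquiv x)))) = _
      simp only [facial_dartEquiv, h]
    omega

theorem IsSpherical.minimalPeriod_eq_three_iff (x : V × Fin 4) :
    Function.minimalPeriod (facial R.rot) (R.dartEquiv x) = 3 ↔
      next R.nbr (next R.nbr (next R.nbr x)) = x := by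
  have e : facial R.rot (facial R.rot (facial R.rot (R.dartEquiv x))) =
      R.dartEquiv (next R.nbr (next R.nbr (next R.nbr x))) := by
    simp only [facial_dartEquiv]
  constructor
  · intro h
    have it := Function.iterate_minimalPeriod (f := facial R.rot) (x := R.dartEquiv x)
    rw [h] at it
    exact R.dartEquiv.injective (e.symm.trans it)
  · intro h
    refine (hR.minimalPeriod _).resolve_right fun h4 => ?_
    have := Function.IsPeriodicPt.minimalPeriod_le (f := facial R.rot) (n := 3)
      (x := R.dartEquiv x) (by simp) (by
        change facial R.rot (facial R.rot (facial R.rot (R.dartEquiv x))) = _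
        rw [e, h])
    omega

omit hR in
noncomputable def IsSpherical.embedding (hR : R.IsSpherical) : PlaneEmbedding G where
  rot := R.rot
  rot_fst := R.isRotation.fst
  rot_cyclic := R.isRotation.cyclic
  face := Equiv.Perm.SameCycle.setoid (facial R.rot)
  face_next d := ⟨1, rfl⟩
  sphere_connected u v := by
    obtain ⟨w⟩ := hR.preconnected u v
    induction w with
    | nil => exact .refl _
    | cons h _ ih => exact .trans _ _ _ (.rel _ _ (.inl h)) ih
  euler := by
    have c : Nat.card {d // Function.minimalPeriod (facial R.rot) d = 3} = 24 := by
      rw [← hR.card]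
      exact (Nat.card_congr (R.dartEquiv.subtypeEquiv
        fun x => (hR.minimalPeriod_eq_three_iff x).symm)).symm
    have : Nonempty V := by
      have : Nonempty {d // Function.minimalPeriod (facial R.rot) d = 3} :=
        (Nat.card_pos_iff.1 (c ▸ (by simp : 0 < 24))).1
      exact this.elim fun d => ⟨d.1.fst⟩
    rw [hR.preconnected.card_connectedComponent]
    exact (R.isRotation.euler_iff hR.minimalPeriod _ fun _ _ => Iff.rfl).2 c

theorem IsSpherical.isFourGraph : hR.embedding.IsFourGraph :=
  ⟨R.isRotation.degree, fun d => by
    have := hR.minimalPeriod d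
    rwa [← Equiv.Perm.card_sameCycle] at this⟩

end RotationList

end SimpleGraph

/-! ### Embeddings and colorings of `G0` and `G1`. -/

open SimpleGraph

instance : DecidableEq G0Vertex
  | .inl _, .inl _ => decidable_of_iff _ Sum.inl_injective.eq_iff.symm
  | .inr _, .inr _ => decidable_of_iff _ Sum.inr_injective.eq_iff.symm
  | .inl _, .inr _ => isFalse Sum.inl_ne_inr
  | .inr _, .inl _ => isFalse Sum.inr_ne_inl

instance : DecidableEq G1Vertex
  | .inl _, .inl _ => decidable_of_iff _ (Prod.ext_iff.symm.trans Sum.inl_injective.eq_iff.symm)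
  | .inr _, .inr _ => decidable_of_iff _ (Prod.ext_iff.symm.trans Sum.inr_injective.eq_iff.symm)
  | .inl _, .inr _ => isFalse Sum.inl_ne_inr
  | .inr _, .inl _ => isFalse Sum.inr_ne_inl

instance : DecidableRel G0Rel
  | .inl _, .inl _ => inferInstanceAs (Decidable (∃ _, _))
  | .inr _, .inl _ => inferInstanceAs (Decidable (_ = _))
  | .inl _, .inr _ => inferInstanceAs (Decidable False)
  | .inr _, .inr _ => inferInstanceAs (Decidable False)

instance : DecidableRel G1Rel
  | .inl (_, _), .inl (_, _) => inferInstanceAs (Decidable (_ ∨ _))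
  | .inr (_, _), .inl (_, _) => inferInstanceAs (Decidable (_ ∧ _))
  | .inl _, .inr _ => inferInstanceAs (Decidable False)
  | .inr _, .inr _ => inferInstanceAs (Decidable False)

instance : DecidableRel G0.Adj := fun a b =>
  decidable_of_iff (a ≠ b ∧ (G0Rel a b ∨ G0Rel b a)) Iff.rfl

instance : DecidableRel G1.Adj := fun a b =>
  decidable_of_iff (a ≠ b ∧ (G1Rel a b ∨ G1Rel b a)) Iff.rfl

/-- The neighbors of the vertices of `G1`, in cyclic order. -/
def G1nbr : G1Vertex → Fin 4 → G1Vertex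
  | .inl (v, i) =>
    if v.IsEven then ![.inl (v.flip i, i), .inr (i + 1, v (i + 1)), .inl (v, i + 2), .inl (v, i + 1)]
    else ![.inl (v.flip i, i), .inr (i + 2, v (i + 2)), .inl (v, i + 1), .inl (v, i + 2)]
  | .inr (k, b) => fun j =>
    let v : CubeVertex := fun i =>
      if i = k then b else if i = k + 1 then (j = 1 ∨ j = 2) else xor b (j = 0 ∨ j = 1)
    .inl (v, if v.IsEven then k + 2 else k + 1)

/-- The five-coloring of `G1`. -/
def G1color : G1Vertex → Fin 5
  | .inl (v, i) =>
    1 + (if xor (xor (v 0) (v 1)) (i = 2) then 1 else 0) +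
      if xor (xor (v 0) (v 2)) (i = 1) then 2 else 0
  | .inr _ => 0

def G1rotation : RotationList G1 where
  nbr := G1nbr
  inj := by decide +kernel
  adj_iff := by decide +kernel

/-- Serves to prove connectedness. If `v i` is true, the cube edge leads down, by 4 - 2. Otherwise a
triangle edge leads down, to a corner in a direction where `v` is true, or to direction 0 at the
zero vertex. -/
def G1height : G1Vertex → ℕ
  | .inl (v, i) => 4 * ((v 0).toNat + (v 1).toNat + (v 2).toNat) + 2 * (!v i).toNat +
      if i = 0 then 0 else 1
  | .inr _ => 100

theorem G1rotation_isSpherical : G1rotation.IsSpherical where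
  face := by decide +kernel
  card := by rw [Nat.card_eq_fintype_card]; decide +kernel
  preconnected := G1rotation.preconnected G1height (.inl (fun _ => false, 0)) (by decide +kernel)

theorem isDistanceTwoColoring_of_nodup {V : Type*} {G : SimpleGraph V} (R : RotationList G)
    {r : ℕ} (c : V → Fin r)
    (h : ∀ v, (c v ≠ c (R.nbr v 0) ∧ c v ≠ c (R.nbr v 1) ∧ c v ≠ c (R.nbr v 2) ∧
      c v ≠ c (R.nbr v 3)) ∧ ∀ i j, c (R.nbr v i) = c (R.nbr v j) → i = j) :
    IsDistanceTwoColoring G c := by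
  have hne : ∀ v i, c v ≠ c (R.nbr v i) := by
    intro v i
    have := (h v).1
    fin_cases i <;> tauto
  rintro v x (rfl | hx) y (rfl | hy) hxy
  · rfl
  · obtain ⟨i, rfl⟩ := (R.adj_iff _ _).1 hy
    exact absurd hxy (hne _ i)
  · obtain ⟨i, rfl⟩ := (R.adj_iff _ _).1 hx
    exact absurd hxy.symm (hne _ i)
  · obtain ⟨i, rfl⟩ := (R.adj_iff _ _).1 hx
    obtain ⟨j, rfl⟩ := (R.adj_iff _ _).1 hy
    rw [(h v).2 i j hxy]

theorem G1color_isDistanceTwoColoring : IsDistanceTwoColoring G1 G1color :=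
  isDistanceTwoColoring_of_nodup G1rotation G1color (by decide +kernel)

/-- The neighbors of the vertices of `G0`, in cyclic order. -/
def G0nbr : G0Vertex → Fin 4 → G0Vertex
  | .inl v =>
    if v.IsEven then ![.inr (v 0), .inl (v.flip 1), .inl (v.flip 0), .inl (v.flip 2)]
    else ![.inr (v 0), .inl (v.flip 2), .inl (v.flip 0), .inl (v.flip 1)]
  | .inr b => fun j => .inl fun i =>
      if i = 0 then b else if i = 1 then (j = 1 ∨ j = 2) else xor b (j = 0 ∨ j = 1)

/-- The five-coloring of `G0`. -/
def G0color : G0Vertex → Fin 5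
  | .inl v => 1 + (if xor (v 0) (v 1) then 1 else 0) + if xor (v 0) (v 2) then 2 else 0
  | .inr _ => 0

def G0height : G0Vertex → ℕ
  | .inl v => (v 0).toNat + (v 1).toNat + (v 2).toNat
  | .inr _ => 100

def G0rotation : RotationList G0 where
  nbr := G0nbr
  inj := by decide +kernel
  adj_iff := by decide +kernel

theorem G0rotation_isSpherical : G0rotation.IsSpherical where
  face := by decide +kernel
  card := by rw [Nat.card_eq_fintype_card]; decide +kernel
  preconnected := G0rotation.preconnected G0height (.inl fun _ => false) (by decide +kernel)

/-- Exactly the antipodal vertices of the cube share a color, as do the two inserted vertices;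
neither kind of pair is within distance two. -/
theorem G0color_isDistanceTwoColoring : IsDistanceTwoColoring G0 G0color :=
  isDistanceTwoColoring_of_nodup G0rotation G0color (by decide +kernel)

/-! ### From bijections of darts to isomorphisms of plane graphs. -/

theorem Equiv.Perm.sameCycle_iff_of_semiconj {α β : Type*} [Finite α] [Finite β]
    {f : Equiv.Perm α} {g : Equiv.Perm β} {F : α → β} (hF : Function.Injective F)
    (h : ∀ x, F (f x) = g (F x)) (x y : α) : f.SameCycle x y ↔ g.SameCycle (F x) (F y) := by
  have hpow : ∀ (n : ℕ) x, F ((f ^ n) x) = (g ^ n) (F x) := by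
    intro n x
    induction n with
    | zero => rfl
    | succ n ih => rw [pow_succ', Equiv.Perm.mul_apply, h, ih, pow_succ', Equiv.Perm.mul_apply]
  constructor
  · intro hxy
    obtain ⟨n, rfl⟩ := hxy.exists_nat_pow_eq
    exact ⟨n, by rw [zpow_natCast, hpow]⟩
  · intro hxy
    obtain ⟨n, hn⟩ := hxy.exists_nat_pow_eq
    rw [← hpow] at hn
    exact ⟨n, by rw [zpow_natCast]; exact hF hn⟩

namespace PlaneEmbedding

variable {V W : Type*} {G : SimpleGraph V} {H : SimpleGraph W}

/-- A bijection between the darts that respects their sources and reversal comes from an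
isomorphism of the graphs. -/
theorem exists_iso_of_bijective (hG : ∀ v, ∃ d : G.Dart, d.fst = v)
    (hH : ∀ w, ∃ d : H.Dart, d.fst = w) {F : G.Dart → H.Dart} (hF : Function.Bijective F)
    (hfst : ∀ d e, d.fst = e.fst ↔ (F d).fst = (F e).fst) (hs : ∀ d, F d.symm = (F d).symm) :
    ∃ φ : G ≃g H, ∀ d, φ.toHom.mapDart d = F d := by
  choose δ hδ using hG
  have hφ : ∀ d, (F (δ d.fst)).fst = (F d).fst := fun d => (hfst _ _).1 (hδ _)
  have hφ' : ∀ d, (F (δ d.snd)).fst = (F d).snd := by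
    intro d
    have := hφ d.symm
    rw [hs] at this
    exact this
  let f : V → W := fun v => (F (δ v)).fst
  have hf : Function.Bijective f := by
    constructor
    · intro v w h
      rw [← hδ v, ← hδ w]
      exact (hfst _ _).2 h
    · intro w
      obtain ⟨e, rfl⟩ := hH w
      obtain ⟨d, rfl⟩ := hF.2 e
      exact ⟨d.fst, hφ d⟩
  refine ⟨⟨Equiv.ofBijective f hf, ?_⟩, fun d => Dart.ext _ _ (Prod.ext (hφ d) (hφ' d))⟩
  intro v w
  constructor
  · intro h
    obtain ⟨d, hd⟩ := hF.2 ⟨(f v, f w), h⟩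
    have h1 : d.fst = v := hf.1 ((hφ d).trans (by rw [hd]))
    have h2 : d.snd = w := hf.1 ((hφ' d).trans (by rw [hd]))
    rw [← h1, ← h2]
    exact d.adj
  · intro h
    have h1 : f v = (F ⟨(v, w), h⟩).fst := hφ ⟨(v, w), h⟩
    have h2 : f w = (F ⟨(v, w), h⟩).snd := hφ' ⟨(v, w), h⟩
    change H.Adj (f v) (f w)
    rw [h1, h2]
    exact Dart.adj _

variable [Finite V] [Finite W] {P : PlaneEmbedding G} {Q : PlaneEmbedding H}

theorem IsFourGraph.exists_dart (hP : P.IsFourGraph) (v : V) : ∃ d : G.Dart, d.fst = v := by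
  have : (G.neighborSet v).Nonempty := by
    rw [← Set.ncard_pos, hP.1 v]
    norm_num
  obtain ⟨w, hw⟩ := this
  exact ⟨⟨(v, w), hw⟩, rfl⟩

theorem fst_eq_iff (P : PlaneEmbedding G) (d e : G.Dart) :
    d.fst = e.fst ↔ P.rot.SameCycle d e := by
  refine ⟨P.rot_cyclic d e, fun h => ?_⟩
  obtain ⟨n, rfl⟩ := h.exists_nat_pow_eq
  clear h
  induction n with
  | zero => rfl
  | succ n ih => rw [pow_succ', Equiv.Perm.mul_apply, P.rot_fst, ih]

theorem IsFourGraph.isIsomorphic (hP : P.IsFourGraph) (hQ : Q.IsFourGraph)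
    {F : G.Dart → H.Dart} (hF : Function.Bijective F) (hr : ∀ d, F (P.rot d) = Q.rot (F d))
    (hs : ∀ d, F d.symm = (F d).symm) : P.IsIsomorphic Q := by
  obtain ⟨φ, hφ⟩ := exists_iso_of_bijective hP.exists_dart hQ.exists_dart hF (fun d e => by
    rw [P.fst_eq_iff, Q.fst_eq_iff, Equiv.Perm.sameCycle_iff_of_semiconj hF.1 hr]) hs
  refine ⟨φ, .inl ⟨fun d => by rw [hφ, hφ, hr], fun d e => ?_⟩⟩
  rw [hφ, hφ, hP.face_iff, hQ.face_iff]
  exact Equiv.Perm.sameCycle_iff_of_semiconj hF.1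
    (fun d => by rw [facial_apply, facial_apply, hr, hs]) d e

theorem IsFourGraph.isIsomorphic_of_reversing (hP : P.IsFourGraph) (hQ : Q.IsFourGraph)
    {F : G.Dart → H.Dart} (hF : Function.Bijective F) (hr : ∀ d, Q.rot (F (P.rot d)) = F d)
    (hs : ∀ d, F d.symm = (F d).symm) : P.IsIsomorphic Q := by
  have hr' : ∀ d, F (P.rot⁻¹ d) = Q.rot (F d) := by
    intro d
    have := hr (P.rot⁻¹ d)
    rwa [← Equiv.Perm.mul_apply, mul_inv_cancel, Equiv.Perm.one_apply, eq_comm] at this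
  obtain ⟨φ, hφ⟩ := exists_iso_of_bijective hP.exists_dart hQ.exists_dart hF (fun d e => by
    rw [P.fst_eq_iff, Q.fst_eq_iff, ← Equiv.Perm.sameCycle_inv,
      Equiv.Perm.sameCycle_iff_of_semiconj hF.1 hr']) hs
  refine ⟨φ, .inr ⟨fun d => by rw [hφ, hφ, hr], fun d e => ?_⟩⟩
  rw [hφ, hφ, hP.face_iff, hQ.face_iff, ← Equiv.Perm.sameCycle_iff_of_semiconj
    (f := facial P.rot⁻¹) hF.1 (fun d => by rw [facial_apply, facial_apply, hr', hs])]
  let S : Equiv.Perm G.Dart := Function.Involutive.toPerm _ Dart.symm_involutive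
  have hS : S⁻¹ = S := Function.Involutive.toPerm_symm _
  -- The inverse rotation traverses the same faces backwards, on the other side of each dart.
  have h1 : facial P.rot⁻¹ = S * (facial P.rot)⁻¹ * S⁻¹ := by
    change P.rot⁻¹ * S = S * (P.rot * S)⁻¹ * S⁻¹
    rw [mul_inv_rev, hS, ← mul_assoc]
    nth_rewrite 2 [← hS]
    rw [inv_mul_cancel, one_mul]
  rw [h1, Equiv.Perm.sameCycle_conj, Equiv.Perm.sameCycle_inv, hS]
  rfl

end PlaneEmbedding

/-! ### Labels of `G0` and `G1` and uniqueness of their colorings. -/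

namespace SimpleGraph.RotationList.IsSpherical

variable {V : Type*} [Finite V] [DecidableEq V] {G : SimpleGraph V} {R : RotationList G}
  (hR : R.IsSpherical) {c : V → Fin 5} (hc : IsDistanceTwoColoring G c)

noncomputable abbrev colored : ColoredMap G.Dart := hR.isFourGraph.colored hc

theorem r_dartEquiv (x : V × Fin 4) :
    (hR.colored hc).r (R.dartEquiv x) = R.dartEquiv (x.1, x.2 + 1) := R.rot_dartEquiv x

theorem s_dartEquiv (x : V × Fin 4) :
    (hR.colored hc).s (R.dartEquiv x) = R.dartEquiv (R.nbr x.1 x.2, back R.nbr x) :=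
  R.symm_dartEquiv x

theorem label_dartEquiv (x : V × Fin 4) : (hR.colored hc).label (R.dartEquiv x) = tri ↔
    next R.nbr (next R.nbr (next R.nbr x)) = x := by
  rw [hR.isFourGraph.label_eq_tri_iff hc, ← hR.minimalPeriod_eq_three_iff]
  rfl

theorem state_injective_left (h : ∀ x y : V × Fin 4, c x.1 = c y.1 →
    c (R.nbr x.1 x.2) = c (R.nbr y.1 y.2) → c (R.nbr x.1 (x.2 + 1)) = c (R.nbr y.1 (y.2 + 1)) →
    c (R.nbr x.1 (x.2 + 1 + 1)) = c (R.nbr y.1 (y.2 + 1 + 1)) → x = y) :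
    Function.Injective (hR.colored hc).state := by
  intro d e hde
  obtain ⟨x, rfl⟩ := R.dartEquiv.surjective d
  obtain ⟨y, rfl⟩ := R.dartEquiv.surjective e
  have h0 := congrFun hde 0
  have h1 := congrFun hde 1
  have h2 : (hR.colored hc).color ((hR.colored hc).s ((hR.colored hc).r (R.dartEquiv x))) =
    (hR.colored hc).color ((hR.colored hc).s ((hR.colored hc).r (R.dartEquiv y))) :=
    congrFun hde 2
  have h3 : (hR.colored hc).color
      ((hR.colored hc).s ((hR.colored hc).r ((hR.colored hc).r (R.dartEquiv x)))) =
    (hR.colored hc).color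
      ((hR.colored hc).s ((hR.colored hc).r ((hR.colored hc).r (R.dartEquiv y)))) :=
    congrFun hde 3
  simp only [r_dartEquiv] at h2 h3
  rw [h x y h0 h1 h2 h3]

theorem color_unique {c' : V → Fin 5} (hc' : IsDistanceTwoColoring G c')
    (hs : ColoredMap.SameKinds (hR.colored hc') (hR.colored hc)) {x : V × Fin 4}
    (hx : (hR.colored hc').labelled.kind (R.dartEquiv x) =
      (hR.colored hc).labelled.kind (R.dartEquiv x)) :
    ∃ π : Equiv.Perm (Fin 5), c' = π ∘ c := by
  obtain ⟨π, hπ⟩ := ColoredMap.exists_alike hx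
  exact ⟨π, funext fun v => ColoredMap.color_eq_of_alike
    (M := hR.colored hc') (N := hR.colored hc) (hR.isFourGraph.transitive hc) rfl rfl
    hs hπ (R.dartEquiv (v, 0))⟩

theorem kind_dartEquiv (x : V × Fin 4) : (hR.colored hc).labelled.kind (R.dartEquiv x) =
    ((hR.colored hc).label (R.dartEquiv x), (hR.colored hc).label (R.dartEquiv (x.1, x.2 + 1)),
      (hR.colored hc).label (R.dartEquiv (x.1, x.2 + 1 + 1)),
      (hR.colored hc).label (R.dartEquiv (x.1, x.2 + 1 + 1 + 1))) := by
  change ((hR.colored hc).label _, (hR.colored hc).label ((hR.colored hc).r _),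
    (hR.colored hc).label ((hR.colored hc).r ((hR.colored hc).r _)),
    (hR.colored hc).label ((hR.colored hc).r ((hR.colored hc).r ((hR.colored hc).r _)))) = _
  simp only [r_dartEquiv]

end SimpleGraph.RotationList.IsSpherical

open RotationList

/-- Which corners are labelled `tri` depends only on the embedding. So the kind at this dart is the
same for all colorings, as uniqueness requires. -/
theorem G0_kind {c : G0Vertex → Fin 5} (hc : IsDistanceTwoColoring G0 c) :
    (G0rotation_isSpherical.colored hc).labelled.kind (G0rotation.dartEquiv (.inr false, 0)) =
      (tri, tri, tri, tri) ∧ (G0rotation_isSpherical.colored hc).labelled.IsWorld0 := by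
  have h : ∀ i, (G0rotation_isSpherical.colored hc).label (G0rotation.dartEquiv (.inr false, i)) =
      tri := by
    simp only [IsSpherical.label_dartEquiv]
    decide +kernel
  constructor
  · rw [IsSpherical.kind_dartEquiv]
    simp only [h]
  · refine LabelledMap.isWorld0_of_tri_tri _ (G0rotation_isSpherical.isFourGraph.transitive hc)
      (h 0) ?_
    change (G0rotation_isSpherical.colored hc).label
      ((G0rotation_isSpherical.colored hc).r _) = _
    rw [IsSpherical.r_dartEquiv, h]

/-- The dart leads from a triangle to an inserted vertex. The positions of the triangles at its two
ends, which do not depend on the coloring, exclude `IsWorld0` and the mirrored world. -/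
theorem G1_kind {c : G1Vertex → Fin 5} (hc : IsDistanceTwoColoring G1 c) :
    (G1rotation_isSpherical.colored hc).labelled.kind
        (G1rotation.dartEquiv (.inl (fun _ => false, 0), 1)) = (two, two, tri, one) ∧
      (G1rotation_isSpherical.colored hc).labelled.IsWorld1 := by
  set M := G1rotation_isSpherical.colored hc with hM
  set x := G1rotation.dartEquiv (.inl (fun _ => false, 0), 1) with hx
  have corner : ∀ i, M.label (G1rotation.dartEquiv (.inl (fun _ => false, 0), i)) = tri ↔
      i = 3 := by
    simp only [hM, IsSpherical.label_dartEquiv]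
    decide +kernel
  have center : ∀ i, M.label (G1rotation.dartEquiv (.inr (1, false), i)) ≠ tri := by
    simp only [ne_eq, hM, IsSpherical.label_dartEquiv]
    decide +kernel
  have back_x : back G1rotation.nbr (.inl (fun _ => false, 0), 1) = 3 := by decide +kernel
  have kx : ∀ a b e f, M.labelled.kind x = (a, b, e, f) → (a ≠ tri ∧ b ≠ tri ∧ e = tri ∧ f ≠ tri) := by
    intro a b e f h
    rw [hx, hM, IsSpherical.kind_dartEquiv, ← hM] at h
    simp only [Prod.mk.injEq] at h
    obtain ⟨rfl, rfl, rfl, rfl⟩ := h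
    simp only [ne_eq, corner]
    decide
  have ks : ∀ a b e f, M.labelled.kind (M.s x) = (a, b, e, f) →
      (a ≠ tri ∧ b ≠ tri ∧ e ≠ tri ∧ f ≠ tri) := by
    intro a b e f h
    rw [hx, hM, IsSpherical.s_dartEquiv, IsSpherical.kind_dartEquiv, ← hM] at h
    simp only [Prod.mk.injEq] at h
    obtain ⟨rfl, rfl, rfl, rfl⟩ := h
    exact ⟨center _, center _, center _, center _⟩
  rcases M.labelled.isWorld_trichotomy (G1rotation_isSpherical.isFourGraph.transitive hc)
    (G1rotation_isSpherical.isFourGraph.exists_tri hc) with h | h | h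
  · rcases h x with h | h | h | h | h <;> simpa using kx _ _ _ _ h.1
  · refine ⟨?_, h⟩
    rcases h x with h | h | h | h | h
    · simpa using kx _ _ _ _ h.1
    · simpa using kx _ _ _ _ h.1
    · simpa using kx _ _ _ _ h.1
    · exact h.1
    · simpa using kx _ _ _ _ h.1
  · have km : ∀ d a b e f, M.labelled.mirror.kind d = (LabelledMap.swapLabel a,
      LabelledMap.swapLabel b, LabelledMap.swapLabel e, LabelledMap.swapLabel f) →
      M.labelled.kind d = (b, a, f, e) := fun d a b e f h => M.labelled.kind_mirror.1 h
    rcases h x with h | h | h | h | h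
    · simpa using kx _ _ _ _ (km _ tri two one one h.1)
    · simpa using kx _ _ _ _ (km _ one tri two one h.1)
    -- Here the labels at the start of the dart fit, but its end, an inserted vertex, would lie on a
    -- triangle.
    · simpa using ks _ _ _ _ (km _ two one one tri h.2)
    · simpa using kx _ _ _ _ (km _ one one tri two h.1)
    · simpa using kx _ _ _ _ (km _ one one one one h.1)

set_option synthInstance.maxSize 1000 in
set_option synthInstance.maxHeartbeats 200000 in
theorem G0_state_injective :
    Function.Injective (G0rotation_isSpherical.colored G0color_isDistanceTwoColoring).state :=
  IsSpherical.state_injective_left _ _ (by decide +kernel)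

-- `G1` has 120 darts, as many as there are orderings of the five colors, so every ordering occurs
-- exactly once.
set_option synthInstance.maxSize 1000 in
set_option synthInstance.maxHeartbeats 200000 in
theorem G1_state_injective :
    Function.Injective (G1rotation_isSpherical.colored G1color_isDistanceTwoColoring).state :=
  IsSpherical.state_injective_left _ _ (by decide +kernel)

theorem hasUniqueDistanceTwoFiveColoring_G0 : HasUniqueDistanceTwoFiveColoring G0 :=
  ⟨G0color, G0color_isDistanceTwoColoring, fun _ hc' =>
    IsSpherical.color_unique _ G0color_isDistanceTwoColoring hc'
      (ColoredMap.sameKinds_of_isWorld0 (G0_kind hc').2 (G0_kind _).2)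
      ((G0_kind hc').1.trans (G0_kind _).1.symm)⟩

theorem hasUniqueDistanceTwoFiveColoring_G1 : HasUniqueDistanceTwoFiveColoring G1 :=
  ⟨G1color, G1color_isDistanceTwoColoring, fun _ hc' =>
    IsSpherical.color_unique _ G1color_isDistanceTwoColoring hc'
      (ColoredMap.sameKinds_of_isWorld1 (G1_kind hc').2 (G1_kind _).2)
      ((G1_kind hc').1.trans (G1_kind _).1.symm)⟩

/-! ### The classification. -/

theorem LabelledMap.IsWorld0.exists_kind {D : Type*} {M : LabelledMap D} (h : M.IsWorld0) (d : D) :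
    ∃ e, M.kind e = (tri, tri, tri, tri) := by
  have key : ∀ d, M.kind d = (tri, tri, one, two) → ∃ e, M.kind e = (tri, tri, tri, tri) := by
    intro d hd
    rcases h d with h | h | h | h | h
    · exact ⟨d, h.1⟩
    · exact ⟨_, h.2⟩
    all_goals (rw [h.1] at hd; simp at hd)
  rcases h d with h | h | h | h | h
  · exact ⟨d, h.1⟩
  · exact ⟨_, h.2⟩
  · exact key _ (M.kind_r3 h.1)
  · exact key _ (M.kind_r h.1)
  · exact key _ (M.kind_r (M.kind_r h.1))

theorem LabelledMap.IsWorld1.exists_kind {D : Type*} {M : LabelledMap D} (h : M.IsWorld1) (d : D) :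
    ∃ e, M.kind e = (two, two, tri, one) := by
  rcases h d with h | h | h | h | h
  · exact ⟨_, M.kind_r (M.kind_r h.1)⟩
  · exact ⟨_, M.kind_r3 h.1⟩
  · exact ⟨_, M.kind_r h.1⟩
  · exact ⟨d, h.1⟩
  · exact ⟨_, h.2⟩

namespace PlaneEmbedding

variable {V : Type*} [Finite V] {G : SimpleGraph V} {P : PlaneEmbedding G}

theorem IsIsomorphic.exists_coloring {W : Type*} [Finite W] {H : SimpleGraph W}
    {Q : PlaneEmbedding H} (h : P.IsIsomorphic Q) {r : ℕ} {c : W → Fin r}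
    (hc : IsDistanceTwoColoring H c) : ∃ c : V → Fin r, IsDistanceTwoColoring G c := by
  obtain ⟨φ, -⟩ := h
  refine ⟨c ∘ φ, fun v x hx y hy hxy => φ.injective (hc (φ v) ?_ ?_ hxy)⟩
  · rcases hx with rfl | hx
    · exact .inl rfl
    · exact .inr (φ.map_adj_iff.2 hx)
  · rcases hy with rfl | hy
    · exact .inl rfl
    · exact .inr (φ.map_adj_iff.2 hy)

/-- The classification of the four-graphs with a distance-two five-coloring. -/
theorem IsFourGraph.isIsomorphic_of_coloring (hP : P.IsFourGraph) {c : V → Fin 5}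
    (hc : IsDistanceTwoColoring G c) :
    P.IsIsomorphic G0rotation_isSpherical.embedding ∨
      P.IsIsomorphic G1rotation_isSpherical.embedding := by
  obtain ⟨d, -⟩ := hP.exists_tri hc
  rcases (hP.colored hc).labelled.isWorld_trichotomy (hP.transitive hc) (hP.exists_tri hc)
    with h | h | h
  · left
    obtain ⟨e, he⟩ := h.exists_kind d
    obtain ⟨k, w⟩ := G0_kind G0color_isDistanceTwoColoring
    obtain ⟨f, fr, fs, fl⟩ := ColoredMap.exists_hom (hP.transitive hc)
      (ColoredMap.sameKinds_of_isWorld0 h w) G0_state_injective (he.trans k.symm)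
    refine hP.isIsomorphic G0rotation_isSpherical.isFourGraph
      (ColoredMap.bijective_of_card (G0rotation_isSpherical.isFourGraph.transitive _) (n := 24)
        (by simp) (hP.card_tri hc) (G0rotation_isSpherical.isFourGraph.card_tri _) f fr fs fl) fr fs
  · right
    obtain ⟨e, he⟩ := h.exists_kind d
    obtain ⟨k, w⟩ := G1_kind G1color_isDistanceTwoColoring
    obtain ⟨f, fr, fs, fl⟩ := ColoredMap.exists_hom (hP.transitive hc)
      (ColoredMap.sameKinds_of_isWorld1 h w) G1_state_injective (he.trans k.symm)
    refine hP.isIsomorphic G1rotation_isSpherical.isFourGraph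
      (ColoredMap.bijective_of_card (G1rotation_isSpherical.isFourGraph.transitive _) (n := 24)
        (by simp) (hP.card_tri hc) (G1rotation_isSpherical.isFourGraph.card_tri _) f fr fs fl) fr fs
  · right
    obtain ⟨k, w⟩ := G1_kind G1color_isDistanceTwoColoring
    have ht := LabelledMap.Transitive.mirror (hP.transitive hc)
    rw [← ColoredMap.mirror_labelled] at h ht
    obtain ⟨e, he⟩ := h.exists_kind d
    obtain ⟨f, fr, fs, fl⟩ := ColoredMap.exists_hom ht
      (ColoredMap.sameKinds_of_isWorld1 h w) G1_state_injective (he.trans k.symm)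
    -- The corner of `d` in the mirror image is the original corner of `rot d`, so `rot` matches the
    -- two counts.
    have hcard : Nat.card {d // (hP.colored hc).mirror.label d = tri} = 24 := by
      rw [← hP.card_tri hc]
      refine Nat.card_congr (P.rot.subtypeEquiv fun d => ?_)
      rw [ColoredMap.mirror_label, LabelledMap.swapLabel_eq_tri]
      rfl
    refine hP.isIsomorphic_of_reversing G1rotation_isSpherical.isFourGraph
      (ColoredMap.bijective_of_card (G1rotation_isSpherical.isFourGraph.transitive _) (n := 24)
        (by simp) hcard (G1rotation_isSpherical.isFourGraph.card_tri _) f fr fs fl) (fun d => ?_) fs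
    -- The rotation of the mirror image is `rot` applied three times, which undoes `rot`; hence the
    -- isomorphism reverses the orientation.
    have := fr (P.rot d)
    exact this.symm.trans (congrArg f (hP.isRotation.rot_four d))

end PlaneEmbedding

theorem theorem6p2 :
    ∃ (P₀ : PlaneEmbedding G0) (P₁ : PlaneEmbedding G1),
      P₀.IsFourGraph ∧ P₁.IsFourGraph ∧
      (∀ (V : Type*) [Finite V] (G : SimpleGraph V) (P : PlaneEmbedding G), P.IsFourGraph →
        ((∃ c : V → Fin 5, IsDistanceTwoColoring G c) ↔
          P.IsIsomorphic P₀ ∨ P.IsIsomorphic P₁)) ∧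
      HasUniqueDistanceTwoFiveColoring G0 ∧ HasUniqueDistanceTwoFiveColoring G1 := by
  refine ⟨G0rotation_isSpherical.embedding, G1rotation_isSpherical.embedding,
    G0rotation_isSpherical.isFourGraph, G1rotation_isSpherical.isFourGraph,
    fun V _ G P hP => ⟨fun ⟨c, hc⟩ => hP.isIsomorphic_of_coloring hc, ?_⟩,
    hasUniqueDistanceTwoFiveColoring_G0, hasUniqueDistanceTwoFiveColoring_G1⟩
  rintro (h | h)
  · exact h.exists_coloring G0color_isDistanceTwoColoring
  · exact h.exists_coloring G1color_isDistanceTwoColoring
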